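/- Let $n\ge 1$, let $T^n=\{z\in\mathbb C^n:|z_j|=1,\ 1\le j\le n\}$, with covering $\pi\colon\mathbb R^n\to T^n$, $\pi(\theta)=(e^{i\theta_1},\dots,e^{i\theta_n})$, and for $r>0$ let $S_r=\{\theta\in\mathbb C^n: |\operatorname{Im}\theta_j|<r,\ 1\le j\le n\}$. A diffeomorphism $\Phi$ of $T^n$ is called volume-preserving if $\Phi^*d\theta=d\theta$, where $d\theta=d\theta_1\wedge\dots\wedge d\theta_n$; a lifting of $\Phi$ is a continuous map $\widetilde\Phi\colon\mathbb R^n\to\mathbb R^n$ with $\pi\circ\widetilde\Phi=\Phi\circ\pi$. There is a constant $\epsilon>0$, depending only on $n$, with the following property. Let $0<r<1$, let $h$ be a holomorphic function on $S_r$ that is $2\pi$-periodic in each variable and real on $\mathbb R^n$, and suppose that $$\|h\|_r=\sup_{\theta\in S_r}|h(\theta)|\le\epsilon r^3 .$$ Put $\mu(\theta)=\theta_1+h(\theta)$. Then there is exactly one $2\pi$-periodic function $k\colon\mathbb R\to\mathbb R$ with $\int_0^{2\pi}k(\theta_1)\,d\theta_1=0$ for which there exist a volume-preserving real-analytic diffeomorphism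 $\Phi$ of $T^n$ and a lifting $\widetilde\Phi$ of $\Phi$ such that $$\mu\circ\widetilde\Phi(\theta)=\theta_1+k(\theta_1)\qquad\text{for all }\theta\in\mathbb R^n .$$ -/

import Mathlib

open scoped ENNReal

noncomputable section

namespace TorusNormalForm

/-- The strip `S_r ⊂ ℂⁿ`: all `θ` with `|Im θ_j| < r` for every `j`. -/
def strip (n : ℕ) (r : ℝ) : Set (Fin n → ℂ) := {θ | ∀ j, |(θ j).im| < r}

/-- The norm `‖h‖_r = sup {|h θ| : θ ∈ S_r}`, as an extended nonnegative real
(so it is `∞` when `h` is unbounded on the strip). -/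
def stripNorm (n : ℕ) (r : ℝ) (h : (Fin n → ℂ) → ℂ) : ℝ≥0∞ := ⨆ θ ∈ strip n r, ‖h θ‖ₑ

/-- `h` is `2π`-periodic in each variable on the strip `S_r`. -/
def IsPeriodicOnStrip (n : ℕ) (r : ℝ) (h : (Fin n → ℂ) → ℂ) : Prop :=
  ∀ θ ∈ strip n r, ∀ j : Fin n, h (θ + Pi.single j ((2 * Real.pi : ℝ) : ℂ)) = h θ

/-- The inclusion `ℝⁿ ⊂ ℂⁿ`. -/
def toComplex {n : ℕ} (θ : Fin n → ℝ) : Fin n → ℂ := fun j => (θ j : ℂ)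

/-- The function `μ(θ) = θ₁ + h(θ)`; the first coordinate has index `0`. -/
def mu {n : ℕ} [NeZero n] (h : (Fin n → ℂ) → ℂ) (θ : Fin n → ℂ) : ℂ := θ 0 + h θ

/-- The torus `Tⁿ = {|z_j| = 1}`. -/
abbrev Torus (n : ℕ) : Type := Fin n → Circle

/-- The universal covering `ℝⁿ → Tⁿ`, `(θ_1, …, θ_n) ↦ (e^{iθ_1}, …, e^{iθ_n})`. -/
def cover {n : ℕ} (θ : Fin n → ℝ) : Torus n := fun j => Circle.exp (θ j)

/-- `F : ℝⁿ → ℝⁿ` is a (continuous) lifting of `Φ : Tⁿ → Tⁿ`. -/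
def IsLift {n : ℕ} (Φ : Torus n → Torus n) (F : (Fin n → ℝ) → (Fin n → ℝ)) : Prop :=
  Continuous F ∧ ∀ θ, cover (F θ) = Φ (cover θ)

/-- Real-analyticity of a self-map of `Tⁿ ⊂ ℂⁿ`. The covering is an analytic local
diffeomorphism, so the angles serve as analytic local coordinates on the source; the target is
an analytic submanifold of `ℂⁿ`. -/
def IsAnalyticMap {n : ℕ} (Φ : Torus n → Torus n) : Prop :=
  ∀ j, AnalyticOnNhd ℝ (fun θ : Fin n → ℝ => (Φ (cover θ) j : ℂ)) Set.univ

/-- A bijection of `Tⁿ` that is an analytic diffeomorphism. -/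
def IsAnalyticDiffeo {n : ℕ} (Φ : Torus n ≃ Torus n) : Prop :=
  IsAnalyticMap Φ ∧ IsAnalyticMap Φ.symm

/-- `Φ` preserves the volume form `dθ = dθ_1 ∧ … ∧ dθ_n`: written in the angles, that is, for a
lifting `F` of `Φ`, the equation `Φ^* dθ = dθ` says `det DF = 1` everywhere. (Two liftings of `Φ`
differ by a constant vector, so the choice of `F` is irrelevant.) -/
def IsVolumePreserving {n : ℕ} (Φ : Torus n → Torus n) : Prop :=
  ∃ F, IsLift Φ F ∧ Differentiable ℝ F ∧ ∀ θ, (fderiv ℝ F θ).det = 1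

end TorusNormalForm

end

/-!
The function `M θ = θ₁ + h θ` is strictly increasing in `θ₁` on `ℝⁿ`: Cauchy's estimate gives
`|∂₁ h| ≤ 2ε r²` there, so `ε = 1/4` suffices. Hence the shear `θ ↦ (M θ, θ₂, …, θₙ)` is an analytic
diffeomorphism commuting with the translations by `2πℤⁿ`, and it turns `M` into the first coordinate
and the Lebesgue measure into a positive analytic periodic density `ρ`.

*Existence.* A Knothe–Rosenblatt rearrangement (`exists_isPeriodicDiffeo_det_eq`) provides a
diffeomorphism with Jacobian determinant `c ρ` whose first coordinate depends on the first coordinate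
only. It is a composition of shears in the last, …, first variable; the shear in the `j`-th variable
is given by the normalized primitive of the density in that variable, and it replaces the density by
its mean. The inverse of the composition of the two diffeomorphisms has constant Jacobian determinant,
equal to one because liftings of homeomorphisms map the fundamental box to a fundamental domain
(`IsLift.abs_det_eq_one`). Composed with this inverse, `M` becomes a function of `θ₁`, and a
translation of `θ₁` normalizes the mean of `k`.

*Uniqueness.* If `u t = t + k t` arises from `M`, then `u` is an increasing homeomorphism, since `M`
has no critical point, and `u` pushes the Lebesgue measure of the circle to the distribution of `M`
modulo `2π`, up to a factor that depends on `n` only. Two such homeomorphisms differ by a rotation of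
the source (`exists_eq_comp_add`), and the normalization of the mean makes the rotation trivial.

*Analyticity.* Two facts are needed: holomorphic functions of `n` variables are real analytic on
`ℝⁿ`, which follows from Cauchy's formula on polydiscs (`analyticAt_comp_toComplex`), and primitives
of an analytic function in one of its variables are analytic (`analyticOnNhd_partialPrimitive`). Both
are instances of `analyticAt_integral_mul_comp` on integrals depending on parameters.
-/

open scoped ENNReal NNReal Topology
open Set Filter MeasureTheory

namespace TorusNormalForm

/-! ### Analyticity of parametric integrals -/

section ParametricIntegral

open scoped Nat

variable {E E' F α : Type*} [NormedAddCommGroup E] [NormedSpace ℝ E] [NormedAddCommGroup E']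
  [NormedSpace ℝ E'] [RCLike F]

/-- `f` has Taylor expansions at all points of `s`, with common radius `r` and common Cauchy
estimates. -/
def HasUniformTaylorOn (f : E → F) (s : Set E) (r C : ℝ) : Prop :=
  ∀ y ∈ s, (∀ k, ‖((k ! : ℝ))⁻¹ • iteratedFDeriv ℝ k f y‖ * r ^ k ≤ C) ∧
    ∀ v, ‖v‖ < r → HasSum (fun k => ((k ! : ℝ))⁻¹ • iteratedFDeriv ℝ k f y fun _ => v) (f (y + v))

/-- Cauchy estimates for the re-expansions of a power series about all nearby points. -/
theorem nnnorm_changeOrigin_mul_pow_le (p : FormalMultilinearSeries ℝ E F) {r : ℝ≥0}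
    (hr : (r : ℝ≥0∞) + r < p.radius) {x : E} (hx : ‖x‖₊ ≤ r) (k : ℕ) :
    ‖p.changeOrigin x k‖₊ * r ^ k ≤
      ∑' s : Σ k l : ℕ, { s : Finset (Fin (k + l)) // s.card = l },
        ‖p (s.1 + s.2.1)‖₊ * r ^ s.2.1 * r ^ s.1 := by
  have hrp : (r : ℝ≥0∞) < p.radius := lt_of_le_of_lt (by simp) hr
  have hxp : (‖x‖₊ : ℝ≥0∞) < p.radius := lt_of_le_of_lt (by exact_mod_cast hx) hrp
  have hsum := p.changeOriginSeries_summable_aux₁ hr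
  have hk := p.changeOriginSeries_summable_aux₂ hrp k
  have h1 : ‖p.changeOrigin x k‖₊ ≤
      ∑' s : Σ l : ℕ, { s : Finset (Fin (k + l)) // s.card = l }, ‖p (k + s.1)‖₊ * r ^ s.1 := by
    refine (p.nnnorm_changeOrigin_le k hxp).trans ?_
    have hle : ∀ s : Σ l : ℕ, { s : Finset (Fin (k + l)) // s.card = l },
        ‖p (k + s.1)‖₊ * ‖x‖₊ ^ s.1 ≤ ‖p (k + s.1)‖₊ * r ^ s.1 := fun s =>
      mul_le_mul_right (pow_le_pow_left₀ (zero_le) hx _) _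
    exact Summable.tsum_le_tsum hle (NNReal.summable_of_le hle hk) hk
  refine (mul_le_mul_left h1 (r ^ k)).trans ?_
  rw [← NNReal.tsum_mul_right]
  exact NNReal.tsum_comp_le_tsum_of_inj hsum (i := fun s => ⟨k, s⟩)
    fun s t hst => eq_of_heq (Sigma.mk.inj_iff.1 hst).2

/-- The Taylor coefficients at nearby points are controlled by changing the origin of the power
series. -/
theorem exists_hasUniformTaylorOn_nhds {f : E → F} {y : E} (hf : AnalyticAt ℝ f y) :
    ∃ s ∈ 𝓝 y, ∃ r > 0, ∃ C, HasUniformTaylorOn f s r C := by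
  obtain ⟨p, R, hp⟩ := hf
  obtain ⟨r, hr0, hr⟩ : ∃ r : ℝ≥0, 0 < r ∧ (r : ℝ≥0∞) + r < R := by
    obtain ⟨q, hq0, hq⟩ := ENNReal.lt_iff_exists_nnreal_btwn.1 hp.r_pos
    refine ⟨q / 2, by simpa using hq0, ?_⟩
    rw [← ENNReal.coe_add, add_halves]
    exact hq
  refine ⟨Metric.closedBall y r, Metric.closedBall_mem_nhds _ (by simpa using hr0), r,
    by simpa using hr0, ((∑' s : Σ k l : ℕ, { s : Finset (Fin (k + l)) // s.card = l },
      ‖p (s.1 + s.2.1)‖₊ * r ^ s.2.1 * r ^ s.1 : ℝ≥0) : ℝ), fun z hz => ?_⟩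
  have hzr : ‖z - y‖₊ ≤ r := by
    rw [← NNReal.coe_le_coe, coe_nnnorm, ← dist_eq_norm]
    exact hz
  have hrR : (r : ℝ≥0∞) < R := lt_of_le_of_lt (by simp) hr
  have hzR : (‖z - y‖₊ : ℝ≥0∞) < R := lt_of_le_of_lt (by exact_mod_cast hzr) hrR
  have hq := hp.changeOrigin hzR
  rw [add_sub_cancel] at hq
  have hsub : (r : ℝ≥0∞) ≤ R - ‖z - y‖₊ := by
    refine ENNReal.le_sub_of_add_le_left (by simp) (le_trans ?_ hr.le)
    gcongr
  refine ⟨fun k => ?_, fun v hv => hq.hasSum_iteratedFDeriv ?_⟩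
  · have h1 : ‖iteratedFDeriv ℝ k f z‖ ≤ k ! * ‖p.changeOrigin (z - y) k‖ := by
      refine ContinuousMultilinearMap.opNorm_le_bound (by positivity) fun v => ?_
      rw [hq.iteratedFDeriv_eq_sum_of_completeSpace]
      refine (norm_sum_le_of_le _ fun σ _ => (p.changeOrigin (z - y) k).le_opNorm _).trans ?_
      simp only [Equiv.prod_comp _ fun i => ‖v i‖]
      simp [Fintype.card_perm, mul_assoc]
    have h2 := nnnorm_changeOrigin_mul_pow_le p (hr.trans_le hp.r_le) hzr k
    rw [norm_smul, norm_inv, RCLike.norm_natCast]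
    refine le_trans ?_ (NNReal.coe_le_coe.2 h2)
    push_cast
    gcongr
    rw [inv_mul_le_iff₀ (by positivity)]
    exact h1
  · refine Metric.eball_subset_eball hsub ?_
    rw [Metric.mem_eball, edist_zero_right, enorm_eq_nnnorm]
    exact_mod_cast hv

theorem exists_hasUniformTaylorOn_of_isCompact {f : E → F} {s : Set E} (hs : IsCompact s)
    (hf : AnalyticOnNhd ℝ f s) : ∃ r > 0, ∃ C, HasUniformTaylorOn f s r C := by
  refine hs.induction_on (p := fun s => ∃ r > 0, ∃ C, HasUniformTaylorOn f s r C)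
    ⟨1, one_pos, 0, fun y hy => hy.elim⟩ ?_ ?_ ?_
  · rintro s t hst ⟨r, hr, C, h⟩
    exact ⟨r, hr, C, fun y hy => h y (hst hy)⟩
  · rintro s t ⟨r, hr, C, h⟩ ⟨r', hr', C', h'⟩
    refine ⟨min r r', lt_min hr hr', max C C', ?_⟩
    rintro y (hy | hy)
    · refine ⟨fun k => ((?_ : _ ≤ _).trans ((h y hy).1 k)).trans (le_max_left _ _),
        fun v hv => (h y hy).2 v (hv.trans_le (min_le_left _ _))⟩
      gcongr
      exact min_le_left _ _
    · refine ⟨fun k => ((?_ : _ ≤ _).trans ((h' y hy).1 k)).trans (le_max_right _ _),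
        fun v hv => (h' y hy).2 v (hv.trans_le (min_le_right _ _))⟩
      gcongr
      exact min_le_right _ _
  · intro y hy
    obtain ⟨s, hs, h⟩ := exists_hasUniformTaylorOn_nhds (hf y hy)
    exact ⟨s, mem_nhdsWithin_of_mem_nhds hs, h⟩

/-- An integral over a compact set of analytic functions, precomposed with a continuous family of
linear maps, is analytic: its Taylor series is obtained by integrating the Taylor coefficients of
the integrand, which are bounded uniformly by compactness. -/
theorem analyticAt_integral_mul_comp [TopologicalSpace α] [T2Space α] [SecondCountableTopology α]
    [MeasurableSpace α] [OpensMeasurableSpace α] {ν : Measure α} [IsFiniteMeasureOnCompacts ν]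
    {K : Set α} (hK : IsCompact K) {c : α → F} (hc : ContinuousOn c K) {A : α → E →L[ℝ] E'}
    (hA : ContinuousOn A K) {f : E' → F} {x : E} (hf : ∀ a ∈ K, AnalyticAt ℝ f (A a x)) :
    AnalyticAt ℝ (fun x => ∫ a in K, c a * f (A a x) ∂ν) x := by
  have hAx : ContinuousOn (fun a => A a x) K := hA.clm_apply continuousOn_const
  obtain ⟨r, hr, C, hC⟩ := exists_hasUniformTaylorOn_of_isCompact (hK.image_of_continuousOn hAx)
    (f := f) (by rintro _ ⟨a, ha, rfl⟩; exact hf a ha)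
  replace hC := fun (a : α) (ha : a ∈ K) => hC (A a x) ⟨a, ha, rfl⟩
  obtain ⟨M₀, hM₀⟩ := hK.exists_bound_of_continuousOn hA
  obtain ⟨B₀, hB₀⟩ := hK.exists_bound_of_continuousOn hc
  obtain ⟨M, hM, hAM⟩ : ∃ M > 0, ∀ a ∈ K, ‖A a‖ ≤ M :=
    ⟨max M₀ 1, by positivity, fun a ha => (hM₀ a ha).trans (le_max_left _ _)⟩
  obtain ⟨B, hB, hcB⟩ : ∃ B > 0, ∀ a ∈ K, ‖c a‖ ≤ B :=
    ⟨max B₀ 1, by positivity, fun a ha => (hB₀ a ha).trans (le_max_left _ _)⟩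
  -- the Taylor coefficients of the integrand
  set q : α → FormalMultilinearSeries ℝ E F := fun a k => c a •
    (((k ! : ℝ))⁻¹ • iteratedFDeriv ℝ k f (A a x)).compContinuousLinearMap fun _ => A a with hq
  have hqc : ∀ k, ContinuousOn (fun a => q a k) K := by
    intro k
    refine hc.smul ?_
    have h1 : AnalyticOnNhd ℝ f {y | AnalyticAt ℝ f y} := fun y hy => hy
    have h2 : ContinuousOn (fun a => iteratedFDeriv ℝ k f (A a x)) K := fun a ha =>
      (h1.iteratedFDeriv_of_isOpen (isOpen_analyticAt ℝ f) k _ (hf a ha))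
        |>.continuousAt.comp_continuousWithinAt (f := fun a => A a x) (hAx a ha)
    have h3 := (ContinuousMultilinearMap.compContinuousLinearMapContinuousMultilinear ℝ
      (fun _ : Fin k => E) (fun _ : Fin k => E') F).cont.comp_continuousOn
      (continuousOn_pi.2 fun _ => hA)
    have h4 := h2.const_smul ((k ! : ℝ))⁻¹
    exact h3.clm_apply h4
  have hqb : ∀ a ∈ K, ∀ k, ‖q a k‖ ≤ B * (C * (M / r) ^ k) := by
    intro a ha k
    rw [hq, norm_smul]
    refine mul_le_mul (hcB a ha) ?_ (norm_nonneg _) hB.le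
    refine (ContinuousMultilinearMap.norm_compContinuousLinearMap_le _ _).trans ?_
    rw [Finset.prod_const, Finset.card_univ, Fintype.card_fin, div_pow, mul_div_assoc',
      le_div_iff₀ (by positivity), mul_right_comm]
    refine mul_le_mul ((hC a ha).1 k) (pow_le_pow_left₀ (norm_nonneg _) (hAM a ha) k)
      (by positivity) (le_trans (by positivity) ((hC a ha).1 k))
  have hqi : ∀ k, IntegrableOn (fun a => q a k) K ν := fun k =>
    (hqc k).integrableOn_compact hK
  have hνK : ν K < ∞ := hK.measure_lt_top
  have hKm : MeasurableSet K := hK.isClosed.measurableSet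
  have hr' : 0 < r / M := by positivity
  refine ⟨fun k => ∫ a in K, q a k ∂ν, ENNReal.ofReal (r / M), ?_, by simpa using hr', ?_⟩
  · refine FormalMultilinearSeries.le_radius_of_bound _ (B * C * ν.real K) fun k => ?_
    rw [Real.coe_toNNReal _ hr'.le]
    have h1 := norm_setIntegral_le_of_norm_le_const hνK (f := fun a => q a k)
      (C := B * (C * (M / r) ^ k)) fun a ha => hqb a ha k
    refine (mul_le_mul_of_nonneg_right h1 (by positivity)).trans (le_of_eq ?_)
    rw [div_pow, div_pow]
    field_simp
  · intro u hu
    have hu' : ‖u‖ < r / M := by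
      rw [Metric.mem_eball, edist_zero_right, ← ofReal_norm] at hu
      exact (ENNReal.ofReal_lt_ofReal_iff hr').1 hu
    have hAu : ∀ a ∈ K, ‖A a u‖ < r := fun a ha =>
      calc ‖A a u‖ ≤ M * ‖u‖ := (A a).le_of_opNorm_le (hAM a ha) u
        _ < M * (r / M) := by gcongr
        _ = r := by field_simp
    have happ : ∀ k, (∫ a in K, q a k ∂ν) (fun _ => u) = ∫ a in K, q a k (fun _ => u) ∂ν :=
      fun k => ContinuousMultilinearMap.integral_apply (hqi k) _
    simp only [happ]
    have hqu : ∀ k, IntegrableOn (fun a => q a k fun _ => u) K ν := fun k =>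
      (ContinuousMultilinearMap.apply ℝ (fun _ : Fin k => E) F fun _ => u).integrable_comp (hqi k)
    have hsum := hasSum_integral_of_summable_integral_norm hqu ?_
    · convert! hsum using 1
      refine setIntegral_congr_fun hKm fun a ha => ?_
      have := (((hC a ha).2 _ (hAu a ha)).mul_left (c a)).tsum_eq
      simp only [hq, map_add]
      exact this.symm
    · have hlt : M / r * ‖u‖ < 1 := by
        rw [lt_div_iff₀ hM] at hu'
        rw [div_mul_eq_mul_div, div_lt_one hr]
        linarith
      refine Summable.of_nonneg_of_le (fun k => by positivity) (fun k => ?_)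
        ((summable_geometric_of_lt_one (by positivity) hlt).mul_left (B * C * ν.real K))
      have h2 : ∀ a ∈ K, ‖q a k fun _ => u‖ ≤ B * (C * (M / r) ^ k) * ‖u‖ ^ k := fun a ha => by
        refine ((q a k).le_of_opNorm_le (hqb a ha k) _).trans ?_
        simp
      have h1 := norm_setIntegral_le_of_norm_le_const hνK (f := fun a => ‖q a k fun _ => u‖)
        (C := B * (C * (M / r) ^ k) * ‖u‖ ^ k) fun a ha => by simpa using h2 a ha
      refine ((le_abs_self _).trans h1).trans (le_of_eq ?_)
      rw [mul_pow]
      ring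

end ParametricIntegral

/-! ### Holomorphic functions of several variables are analytic -/

theorem torusMap_mem_closedBall {n : ℕ} (c : Fin n → ℂ) {R : ℝ} (hR : 0 ≤ R) (θ : Fin n → ℝ) :
    torusMap c (fun _ => R) θ ∈ Metric.closedBall c R := by
  rw [mem_closedBall_iff_norm, pi_norm_le_iff_of_nonneg hR]
  intro i
  simp [torusMap, Complex.norm_exp_ofReal_mul_I, abs_of_nonneg hR]

theorem torusMap_apply_ne {n : ℕ} {c w : Fin n → ℂ} {R : ℝ} (hw : w ∈ Metric.ball c R)
    (θ : Fin n → ℝ) (i : Fin n) : torusMap c (fun _ => R) θ i ≠ w i := by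
  intro h
  have hR := Metric.pos_of_mem_ball hw
  have h1 := (norm_le_pi_norm (w - c) i).trans_lt (mem_ball_iff_norm.1 hw)
  rw [Pi.sub_apply, ← h] at h1
  simp [torusMap, Complex.norm_exp_ofReal_mul_I, abs_of_pos hR] at h1

/-- **Cauchy's integral formula** on a polydisc. -/
theorem torusIntegral_prod_inv_mul {n : ℕ} {f : (Fin n → ℂ) → ℂ} {c w : Fin n → ℂ} {R : ℝ}
    (hw : w ∈ Metric.ball c R) (hf : ∀ z ∈ Metric.closedBall c R, DifferentiableAt ℂ f z) :
    torusIntegral (fun z => (∏ i, (z i - w i)⁻¹) * f z) c (fun _ => R) =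
      (2 * Real.pi * Complex.I) ^ n * f w := by
  have hR := Metric.pos_of_mem_ball hw
  induction n with
  | zero => simp [Subsingleton.elim c w]
  | succ n ih =>
    have hint : TorusIntegrable (fun z => (∏ i, (z i - w i)⁻¹) * f z) c (fun _ => R) := by
      refine ContinuousOn.integrableOn_compact isCompact_Icc (Continuous.continuousOn ?_)
      have hT : Continuous (torusMap c fun _ => R) := by unfold torusMap; fun_prop
      refine Continuous.mul (continuous_finsetProd _ fun i _ => ?_) ?_
      · exact Continuous.inv₀ (((continuous_apply i).comp hT).sub continuous_const)
          fun θ => sub_ne_zero.2 (torusMap_apply_ne hw θ i)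
      · exact continuous_iff_continuousAt.2 fun θ =>
          (hf _ (torusMap_mem_closedBall c hR.le θ)).continuousAt.comp (f := torusMap c fun _ => R)
            hT.continuousAt
    have hmem : ∀ x ∈ Metric.closedBall (c 0) R, ∀ y ∈ Metric.closedBall (c ∘ Fin.succ) R,
        (Fin.cons x y : Fin (n + 1) → ℂ) ∈ Metric.closedBall c R := by
      intro x hx y hy
      rw [Metric.mem_closedBall, dist_pi_le_iff hR.le] at hy ⊢
      exact Fin.cases hx hy
    have hw' : w ∘ Fin.succ ∈ Metric.ball (c ∘ Fin.succ) R := by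
      rw [Metric.mem_ball, dist_pi_lt_iff hR] at hw ⊢
      exact fun i => hw i.succ
    have hw0 : w 0 ∈ Metric.ball (c 0) R := by
      rw [Metric.mem_ball, dist_pi_lt_iff hR] at hw
      exact hw 0
    have hslice : ∀ x ∈ Metric.closedBall (c 0) R,
        DifferentiableAt ℂ (fun x => f (Fin.cons x (w ∘ Fin.succ))) x := by
      intro x hx
      refine (hf _ (hmem x hx _ (Metric.ball_subset_closedBall hw'))).comp x
        (f := fun x => (Fin.cons x (w ∘ Fin.succ) : Fin (n + 1) → ℂ)) ?_
      refine differentiableAt_pi.2 (Fin.cases ?_ fun i => ?_)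
      · exact differentiableAt_id
      · exact differentiableAt_const _
    rw [torusIntegral_succ hint]
    have hinner : EqOn (fun x => torusIntegral (fun y : Fin n → ℂ =>
          (∏ i, ((Fin.cons x y : Fin (n + 1) → ℂ) i - w i)⁻¹) * f (Fin.cons x y))
            (c ∘ Fin.succ) ((fun _ => R) ∘ Fin.succ))
        (fun x => (2 * Real.pi * Complex.I) ^ n *
          ((x - w 0)⁻¹ • f (Fin.cons x (w ∘ Fin.succ)))) (Metric.sphere (c 0) R) := by
      intro x hx
      have hx' := Metric.sphere_subset_closedBall hx
      have hih := ih (f := fun y => f (Fin.cons x y)) hw' ?_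
      · simp only [Fin.prod_univ_succ, Fin.cons_zero, Fin.cons_succ, mul_assoc _ _ (f _),
          torusIntegral_const_mul]
        simp only [Function.comp_apply] at hih
        rw [show ((fun _ => R) ∘ Fin.succ : Fin n → ℝ) = fun _ => R from rfl, hih, smul_eq_mul,
          mul_left_comm]
      intro y hy
      refine (hf _ (hmem x hx' y hy)).comp y (f := fun y => (Fin.cons x y : Fin (n + 1) → ℂ)) ?_
      refine differentiableAt_pi.2 (Fin.cases ?_ fun i => ?_)
      · exact differentiableAt_const _
      · exact differentiableAt_apply i y
    rw [circleIntegral.integral_congr hR.le hinner, circleIntegral.integral_const_mul,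
      Complex.circleIntegral_sub_inv_smul_of_differentiable_on_off_countable countable_empty hw0
        (fun x hx => (hslice x hx).continuousAt.continuousWithinAt)
        (fun x hx => hslice x (Metric.ball_subset_closedBall hx.1)), smul_eq_mul, ← mul_assoc,
      ← pow_succ]
    congr 2
    ext i
    refine Fin.cases ?_ (fun i => ?_) i <;> simp

/-- The restriction to `ℝⁿ` of a holomorphic function of `n` variables is real analytic: the Cauchy
kernel `∏ (ζ_j - x_j)⁻¹` is, up to a factor, the fixed function `∏ (1 - v_j)⁻¹` evaluated at
`v_j = x_j / ζ_j`, which is linear in `x`. -/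
theorem analyticAt_comp_toComplex {n : ℕ} {f : (Fin n → ℂ) → ℂ} {U : Set (Fin n → ℂ)}
    (hU : IsOpen U) (hf : DifferentiableOn ℂ f U) {x : Fin n → ℝ} (hx : toComplex x ∈ U) :
    AnalyticAt ℝ (fun y : Fin n → ℝ => f (toComplex y)) x := by
  obtain ⟨R, hR, hRU⟩ := Metric.nhds_basis_closedBall.mem_iff.1 (hU.mem_nhds hx)
  have hfd : ∀ z ∈ Metric.closedBall (toComplex x) R, DifferentiableAt ℂ f z :=
    fun z hz => hf.differentiableAt (hU.mem_nhds (hRU hz))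
  set T := torusMap (toComplex x) fun _ => R with hTdef
  have hT : Continuous T := by unfold T torusMap; fun_prop
  let ζ : (Fin n → ℝ) → Fin n → ℂ := fun a i => R * Complex.exp (a i * Complex.I)
  have hζ : ∀ a i, ζ a i ≠ 0 := fun a i => by simp [ζ, hR.ne']
  let A : (Fin n → ℝ) → (Fin n → ℝ) →L[ℝ] (Fin n → ℂ) := fun a =>
    ContinuousLinearMap.pi fun i => (ζ a i)⁻¹ • Complex.ofRealCLM ∘L ContinuousLinearMap.proj i
  have hA : Continuous A := by
    refine continuous_clm_apply.2 fun v => continuous_pi fun i => ?_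
    have : Continuous fun a => (ζ a i)⁻¹ :=
      Continuous.inv₀ (by unfold ζ; fun_prop) fun a => hζ a i
    exact this.mul (continuous_const (y := (v i : ℂ)))
  let c : (Fin n → ℝ) → ℂ := fun a => Complex.I ^ n * f (T a)
  have hc : Continuous c := continuous_const.mul (continuous_iff_continuousAt.2 fun θ =>
    (hfd _ (torusMap_mem_closedBall _ hR.le θ)).continuousAt.comp (f := T) hT.continuousAt)
  let G : (Fin n → ℂ) → ℂ := fun v => ∏ i, (1 - v i)⁻¹
  have hG : AnalyticAt ℝ G 0 := by
    refine Finset.analyticAt_fun_prod _ fun i _ => AnalyticAt.inv ?_ (by simp)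
    exact analyticAt_const.sub
      ((ContinuousLinearMap.proj (R := ℝ) (φ := fun _ : Fin n => ℂ) i).analyticAt 0)
  have h1 : AnalyticAt ℝ (fun v => ∫ a in Icc (0 : Fin n → ℝ) fun _ => 2 * Real.pi,
      c a * G (A a v)) (x - x) :=
    analyticAt_integral_mul_comp isCompact_Icc hc.continuousOn hA.continuousOn
      fun a _ => by simpa using hG
  have h2 : AnalyticAt ℝ (fun y => ((2 * Real.pi * Complex.I) ^ n)⁻¹ *
      ∫ a in Icc (0 : Fin n → ℝ) fun _ => 2 * Real.pi, c a * G (A a (y - x))) x :=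
    analyticAt_const.mul (h1.comp (f := fun y => y - x) (analyticAt_id.sub analyticAt_const))
  refine h2.congr ?_
  filter_upwards [Metric.ball_mem_nhds x hR] with y hy
  have hy' : toComplex y ∈ Metric.ball (toComplex x) R := by
    rw [Metric.mem_ball, dist_pi_lt_iff hR] at hy ⊢
    intro i
    simpa [toComplex, Complex.dist_eq, ← Complex.ofReal_sub, Real.dist_eq] using hy i
  rw [inv_mul_eq_iff_eq_mul₀ (by simp [Real.pi_ne_zero]), ← torusIntegral_prod_inv_mul hy' hfd,
    torusIntegral]
  refine setIntegral_congr_fun measurableSet_Icc fun a _ => ?_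
  simp only [c, G, smul_eq_mul, ← hTdef]
  have h3 : ∀ i, R * Complex.exp (a i * Complex.I) * Complex.I * (T a i - toComplex y i)⁻¹ =
      Complex.I * (1 - A a (y - x) i)⁻¹ := by
    intro i
    have h4 : T a i - toComplex y i = ζ a i * (1 - A a (y - x) i) := by
      have h6 : T a i = x i + ζ a i := rfl
      have h7 : A a (y - x) i = (ζ a i)⁻¹ * (y i - x i) := by simp [A]
      rw [h6, h7, mul_sub, mul_inv_cancel_left₀ (hζ a i), toComplex]
      ring
    have h5 : R * Complex.exp (a i * Complex.I) = ζ a i := rfl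
    rw [h4, h5, mul_inv]
    have := hζ a i
    field_simp
  rw [← mul_assoc, ← Finset.prod_mul_distrib, Finset.prod_congr rfl fun i _ => h3 i,
    Finset.prod_mul_distrib]
  simp
  ring

variable {n : ℕ}

/-! ### Analytic diffeomorphisms commuting with the deck transformations -/

/-- The vector `2πm ∈ 2πℤⁿ`, as a homomorphism in `m`. -/
noncomputable def latticeHom (n : ℕ) : (Fin n → ℤ) →+ (Fin n → ℝ) where
  toFun m := fun j => m j * (2 * Real.pi)
  map_zero' := by ext; simp
  map_add' m m' := by ext; simp [add_mul]

theorem latticeHom_apply (m : Fin n → ℤ) (j : Fin n) : latticeHom n m j = m j * (2 * Real.pi) := rfl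

theorem latticeHom_single (j : Fin n) (k : ℤ) :
    latticeHom n (Pi.single j k) = Pi.single j (k * (2 * Real.pi)) := by
  ext i
  rcases eq_or_ne i j with rfl | h <;> simp [latticeHom_apply, *]

theorem cover_eq_cover_iff {a b : Fin n → ℝ} :
    cover a = cover b ↔ ∃ m : Fin n → ℤ, a = b + latticeHom n m := by
  simp only [cover, funext_iff, Circle.exp_eq_exp, Pi.add_apply, latticeHom_apply]
  exact Classical.skolem

/-- Periodicity in each variable implies periodicity with respect to the lattice `2πℤⁿ`. -/
theorem apply_add_latticeHom_of_forall_single {X : Type*} {g : (Fin n → ℝ) → X}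
    (hg : ∀ θ j, g (θ + Pi.single j (2 * Real.pi)) = g θ) (θ : Fin n → ℝ) (m : Fin n → ℤ) :
    g (θ + latticeHom n m) = g θ := by
  let P : AddSubgroup (Fin n → ℝ) :=
    { carrier := {v | ∀ θ, g (θ + v) = g θ}
      zero_mem' := fun θ => by rw [add_zero]
      add_mem' := fun {v w} hv hw θ => by rw [← add_assoc, hw, hv]
      neg_mem' := fun {v} hv θ => by rw [← hv (θ + -v), neg_add_cancel_right] }
  have h : latticeHom n m ∈ P := by
    have h1 : latticeHom n m = ∑ j, m j • (Pi.single j (2 * Real.pi) : Fin n → ℝ) := by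
      ext i
      simp [latticeHom_apply, Finset.sum_apply, Pi.single_apply]
    rw [h1]
    exact P.sum_mem fun j _ => P.zsmul_mem (fun θ => hg θ j) _
  exact h θ

/-- An analytic diffeomorphism of `ℝⁿ` which commutes with the translations by `2πℤⁿ`. Such a map
is a lifting of an analytic diffeomorphism of the torus. -/
structure IsPeriodicDiffeo (S : (Fin n → ℝ) ≃ (Fin n → ℝ)) : Prop where
  analytic : AnalyticOnNhd ℝ S univ
  analytic_symm : AnalyticOnNhd ℝ S.symm univ
  add_latticeHom : ∀ θ m, S (θ + latticeHom n m) = S θ + latticeHom n m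

namespace IsPeriodicDiffeo

variable {S S' : (Fin n → ℝ) ≃ (Fin n → ℝ)}

theorem refl : IsPeriodicDiffeo (Equiv.refl (Fin n → ℝ)) :=
  ⟨fun _ _ => analyticAt_id, fun _ _ => analyticAt_id, fun _ _ => rfl⟩

theorem symm (hS : IsPeriodicDiffeo S) : IsPeriodicDiffeo S.symm where
  analytic := hS.analytic_symm
  analytic_symm := hS.analytic
  add_latticeHom θ m := by
    rw [Equiv.symm_apply_eq, hS.add_latticeHom, Equiv.apply_symm_apply]

theorem trans (hS : IsPeriodicDiffeo S) (hS' : IsPeriodicDiffeo S') :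
    IsPeriodicDiffeo (S.trans S') where
  analytic := hS'.analytic.comp hS.analytic fun _ _ => mem_univ _
  analytic_symm := hS.analytic_symm.comp hS'.analytic_symm fun _ _ => mem_univ _
  add_latticeHom θ m := by simp [hS.add_latticeHom, hS'.add_latticeHom]

theorem addRight (v : Fin n → ℝ) : IsPeriodicDiffeo (Equiv.addRight v) where
  analytic _ _ := analyticAt_id.add analyticAt_const
  analytic_symm _ _ := analyticAt_id.add analyticAt_const
  add_latticeHom _ _ := add_right_comm _ _ _

theorem differentiable (hS : IsPeriodicDiffeo S) : Differentiable ℝ S :=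
  fun θ => (hS.analytic θ (mem_univ _)).differentiableAt

theorem continuous (hS : IsPeriodicDiffeo S) : Continuous S := hS.differentiable.continuous

theorem det_fderiv_trans (hS : IsPeriodicDiffeo S) (hS' : IsPeriodicDiffeo S') (θ : Fin n → ℝ) :
    (fderiv ℝ (S.trans S') θ).det = (fderiv ℝ S' (S θ)).det * (fderiv ℝ S θ).det := by
  rw [Equiv.coe_trans, fderiv_comp _ (hS'.differentiable _) (hS.differentiable _)]
  exact LinearMap.det_comp _ _

theorem det_fderiv_symm (hS : IsPeriodicDiffeo S) (θ : Fin n → ℝ) :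
    (fderiv ℝ S.symm θ).det * (fderiv ℝ S (S.symm θ)).det = 1 := by
  have h := hS.det_fderiv_trans hS.symm (S.symm θ)
  rw [Equiv.apply_symm_apply] at h
  rw [← h, Equiv.self_trans_symm, Equiv.coe_refl, fderiv_id]
  exact LinearMap.det_id

end IsPeriodicDiffeo

/-- The global inverse is analytic because it agrees locally with the one given by the analytic
inverse function theorem. -/
theorem analyticOnNhd_symm_of_det_ne_zero {S : (Fin n → ℝ) ≃ (Fin n → ℝ)}
    (hS : AnalyticOnNhd ℝ S univ) (hdet : ∀ θ, (fderiv ℝ S θ).det ≠ 0) :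
    AnalyticOnNhd ℝ S.symm univ := by
  intro y _
  have hA := hS (S.symm y) (mem_univ _)
  let i := (fderiv ℝ S (S.symm y)).toContinuousLinearEquivOfDetNeZero (hdet _)
  have hi : (i : (Fin n → ℝ) →L[ℝ] (Fin n → ℝ)) = fderiv ℝ S (S.symm y) :=
    ContinuousLinearMap.coe_toContinuousLinearEquivOfDetNeZero _ _
  have hstrict : HasStrictFDerivAt S (i : (Fin n → ℝ) →L[ℝ] (Fin n → ℝ)) (S.symm y) := by
    rw [hi]
    exact hA.hasStrictFDerivAt
  let e := hstrict.toOpenPartialHomeomorph S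
  have h1 : AnalyticAt ℝ e.symm (e (S.symm y)) :=
    e.analyticAt_symm' hstrict.mem_toOpenPartialHomeomorph_source hA hi.symm
  have h2 : e (S.symm y) = y := S.apply_symm_apply y
  have h3 := hstrict.image_mem_toOpenPartialHomeomorph_target
  rw [S.apply_symm_apply] at h3
  rw [h2] at h1
  refine h1.congr ?_
  filter_upwards [e.open_target.mem_nhds h3] with z hz
  rw [Equiv.eq_symm_apply]
  exact e.right_inv hz

/-! ### Shears: changing a single coordinate -/

theorem hasDerivAt_comp_update {f : (Fin n → ℝ) → ℝ} {θ : Fin n → ℝ} {j : Fin n} {s : ℝ}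
    (hf : DifferentiableAt ℝ f (Function.update θ j s)) :
    HasDerivAt (fun s => f (Function.update θ j s))
      (fderiv ℝ f (Function.update θ j s) (Pi.single j 1)) s :=
  hf.hasFDerivAt.comp_hasDerivAt s (hasDerivAt_update θ j s)

/-- Conditions on `f` under which replacing the `j`-th coordinate of `θ` by `f θ` is an analytic
diffeomorphism of `ℝⁿ` commuting with the translations by `2πℤⁿ`. -/
structure IsShearFunction (j : Fin n) (f : (Fin n → ℝ) → ℝ) : Prop where
  analytic : AnalyticOnNhd ℝ f univ
  add_latticeHom : ∀ θ m, f (θ + latticeHom n m) = f θ + m j * (2 * Real.pi)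
  fderiv_pos : ∀ θ, 0 < fderiv ℝ f θ (Pi.single j 1)

namespace IsShearFunction

variable {j : Fin n} {f : (Fin n → ℝ) → ℝ}

theorem differentiable (hf : IsShearFunction j f) : Differentiable ℝ f :=
  fun θ => (hf.analytic θ (mem_univ _)).differentiableAt

theorem fderiv_add_latticeHom (hf : IsShearFunction j f) (θ : Fin n → ℝ) (m : Fin n → ℤ) :
    fderiv ℝ f (θ + latticeHom n m) = fderiv ℝ f θ := by
  rw [← fderiv_comp_add_right]
  simp only [hf.add_latticeHom]
  exact fderiv_add_const _

theorem strictMono (hf : IsShearFunction j f) (θ : Fin n → ℝ) :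
    StrictMono fun s => f (Function.update θ j s) :=
  strictMono_of_deriv_pos fun s => by
    rw [(hasDerivAt_comp_update (hf.differentiable _)).deriv]
    exact hf.fderiv_pos _

theorem exists_update_eq (hf : IsShearFunction j f) (θ : Fin n → ℝ) (y : ℝ) :
    ∃ s, f (Function.update θ j s) = y := by
  have hper : ∀ k : ℤ, f (Function.update θ j (k * (2 * Real.pi))) =
      f (Function.update θ j 0) + k * (2 * Real.pi) := by
    intro k
    have h := hf.add_latticeHom (Function.update θ j 0) (Pi.single j k)
    rw [latticeHom_single, Pi.single_eq_same] at h
    rw [← h]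
    congr 1
    ext i
    rcases eq_or_ne i j with rfl | h <;> simp [*]
  refine mem_range_of_exists_le_of_exists_ge
    (hf.differentiable.continuous.comp (continuous_const.update j continuous_id)) ?_ ?_
  · obtain ⟨k, hk⟩ := exists_nat_ge ((f (Function.update θ j 0) - y) / (2 * Real.pi))
    rw [div_le_iff₀ Real.two_pi_pos] at hk
    refine ⟨((-k : ℤ) : ℝ) * (2 * Real.pi), ?_⟩
    simp only [hper]
    push_cast
    linarith
  · obtain ⟨k, hk⟩ := exists_nat_ge ((y - f (Function.update θ j 0)) / (2 * Real.pi))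
    rw [div_le_iff₀ Real.two_pi_pos] at hk
    refine ⟨((k : ℤ) : ℝ) * (2 * Real.pi), ?_⟩
    simp only [hper]
    push_cast
    linarith

theorem bijective (hf : IsShearFunction j f) :
    Function.Bijective fun θ : Fin n → ℝ => Function.update θ j (f θ) := by
  constructor
  · intro θ θ' h
    have hne : ∀ i, i ≠ j → θ i = θ' i := fun i hi => by simpa [hi] using congrFun h i
    have hj : f θ = f θ' := by simpa using congrFun h j
    have hθ' : θ' = Function.update θ j (θ' j) := by
      ext i
      rcases eq_or_ne i j with rfl | hi
      · simp
      · simp [hi, hne]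
    rw [hθ', ← Function.update_eq_self j θ, Function.update_idem] at hj
    have h0 := (hf.strictMono θ).injective hj
    rw [hθ', ← h0, Function.update_eq_self]
  · intro y
    obtain ⟨s, hs⟩ := hf.exists_update_eq y (y j)
    exact ⟨Function.update y j s, by simp [hs]⟩

/-- The shear `θ ↦ (θ_1, …, f θ, …, θ_n)`, with `f θ` in position `j`. -/
noncomputable def equiv (hf : IsShearFunction j f) : (Fin n → ℝ) ≃ (Fin n → ℝ) :=
  Equiv.ofBijective _ hf.bijective

theorem equiv_apply (hf : IsShearFunction j f) (θ : Fin n → ℝ) :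
    hf.equiv θ = Function.update θ j (f θ) := rfl

theorem coe_equiv (hf : IsShearFunction j f) :
    ⇑hf.equiv = fun θ => θ + (f θ - θ j) • (Pi.single j 1 : Fin n → ℝ) := by
  ext θ i
  rcases eq_or_ne i j with rfl | hi <;> simp [equiv_apply, *]

theorem det_fderiv_equiv (hf : IsShearFunction j f) (θ : Fin n → ℝ) :
    (fderiv ℝ hf.equiv θ).det = fderiv ℝ f θ (Pi.single j 1) := by
  have h : HasFDerivAt hf.equiv (ContinuousLinearMap.id ℝ (Fin n → ℝ) +
      (fderiv ℝ f θ - ContinuousLinearMap.proj j).smulRight (Pi.single j 1 : Fin n → ℝ)) θ := by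
    rw [coe_equiv]
    exact (hasFDerivAt_id θ).add (((hf.differentiable θ).hasFDerivAt.sub
      (hasFDerivAt_apply j θ)).smul_const _)
  rw [h.fderiv]
  have h1 := LinearMap.transvection.det
    ((fderiv ℝ f θ - ContinuousLinearMap.proj j : (Fin n → ℝ) →L[ℝ] ℝ) : Module.Dual ℝ (Fin n → ℝ))
    (Pi.single j 1)
  refine Eq.trans ?_ (h1.trans ?_)
  · rfl
  · simp

theorem isPeriodicDiffeo_equiv (hf : IsShearFunction j f) : IsPeriodicDiffeo hf.equiv := by
  have han : AnalyticOnNhd ℝ hf.equiv univ := by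
    rw [coe_equiv]
    intro θ _
    exact analyticAt_id.add (((hf.analytic θ (mem_univ _)).sub
      ((ContinuousLinearMap.proj (R := ℝ) (φ := fun _ : Fin n => ℝ) j).analyticAt θ)).smul
      analyticAt_const)
  refine ⟨han, analyticOnNhd_symm_of_det_ne_zero han fun θ => ?_, fun θ m => ?_⟩
  · rw [det_fderiv_equiv]
    exact (hf.fderiv_pos θ).ne'
  · simp only [coe_equiv, hf.add_latticeHom, Pi.add_apply, latticeHom_apply, add_sub_add_right_eq_sub]
    exact add_right_comm _ _ _

end IsShearFunction

/-! ### Prescribing the Jacobian determinant up to a constant -/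

/-- The primitive `∫_0^{θ_j} ρ(θ_1, …, s, …, θ_n) ds` of `ρ` in the `j`-th variable. -/
noncomputable def partialPrimitive (j : Fin n) (ρ : (Fin n → ℝ) → ℝ) (θ : Fin n → ℝ) : ℝ :=
  ∫ s in (0 : ℝ)..θ j, ρ (Function.update θ j s)

/-- The integral of `ρ` over a period of the `j`-th variable. -/
noncomputable def periodIntegral (j : Fin n) (ρ : (Fin n → ℝ) → ℝ) (θ : Fin n → ℝ) : ℝ :=
  partialPrimitive j ρ (Function.update θ j (2 * Real.pi))

theorem partialPrimitive_update (j : Fin n) (ρ : (Fin n → ℝ) → ℝ) (θ : Fin n → ℝ) (s : ℝ) :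
    partialPrimitive j ρ (Function.update θ j s) =
      ∫ s in (0 : ℝ)..s, ρ (Function.update θ j s) := by
  simp [partialPrimitive]

theorem periodIntegral_update (j : Fin n) (ρ : (Fin n → ℝ) → ℝ) (θ : Fin n → ℝ) (s : ℝ) :
    periodIntegral j ρ (Function.update θ j s) = periodIntegral j ρ θ := by
  simp [periodIntegral]

theorem analyticOnNhd_partialPrimitive (j : Fin n) {ρ : (Fin n → ℝ) → ℝ}
    (hρ : AnalyticOnNhd ℝ ρ univ) : AnalyticOnNhd ℝ (partialPrimitive j ρ) univ := by
  -- rescaling the segment to `[0, 1]` moves `θ_j` from the endpoint into a linear map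
  let A : ℝ → (Fin n → ℝ) →L[ℝ] (Fin n → ℝ) := fun t => ContinuousLinearMap.id ℝ _ +
    ((t - 1) • ContinuousLinearMap.proj j : (Fin n → ℝ) →L[ℝ] ℝ).smulRight (Pi.single j 1)
  have hAx : ∀ t θ, A t θ = Function.update θ j (θ j * t) := by
    intro t θ
    ext i
    rcases eq_or_ne i j with rfl | hi
    · simp [A]
      ring
    · simp [A, hi]
  have hA : Continuous A := by
    refine continuous_clm_apply.2 fun θ => ?_
    simp only [hAx]
    fun_prop
  have heq : partialPrimitive j ρ = fun θ => θ j * ∫ t in Icc (0 : ℝ) 1, 1 * ρ (A t θ) := by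
    ext θ
    have h := intervalIntegral.mul_integral_comp_mul_left (a := 0) (b := 1)
      (f := fun s => ρ (Function.update θ j s)) (θ j)
    rw [mul_zero, mul_one] at h
    rw [partialPrimitive, ← h, intervalIntegral.integral_of_le zero_le_one,
      ← integral_Icc_eq_integral_Ioc]
    simp only [one_mul, hAx]
  rw [heq]
  intro θ _
  exact ((ContinuousLinearMap.proj (R := ℝ) (φ := fun _ : Fin n => ℝ) j).analyticAt θ).mul
    (analyticAt_integral_mul_comp isCompact_Icc continuousOn_const hA.continuousOn
      fun t _ => hρ _ (mem_univ _))

section Density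

variable {j : Fin n} {ρ : (Fin n → ℝ) → ℝ}

theorem continuous_comp_update
    (hρ : AnalyticOnNhd ℝ ρ univ) (θ : Fin n → ℝ) : Continuous fun s => ρ (Function.update θ j s) :=
  hρ.continuous.comp (continuous_const.update j continuous_id)

theorem analyticOnNhd_periodIntegral
    (hρ : AnalyticOnNhd ℝ ρ univ) : AnalyticOnNhd ℝ (periodIntegral j ρ) univ := by
  have h : AnalyticOnNhd ℝ (fun θ : Fin n → ℝ => Function.update θ j (2 * Real.pi)) univ := by
    intro θ _
    refine analyticAt_pi_iff.2 fun i => ?_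
    rcases eq_or_ne i j with rfl | hi
    · simpa using analyticAt_const
    · simp only [Function.update_of_ne hi]
      exact (ContinuousLinearMap.proj (R := ℝ) (φ := fun _ : Fin n => ℝ) i).analyticAt θ
  exact (analyticOnNhd_partialPrimitive j hρ).comp h fun _ _ => mem_univ _

theorem periodIntegral_pos
    (hρ : AnalyticOnNhd ℝ ρ univ)
    (hpos : ∀ θ, 0 < ρ θ) (θ : Fin n → ℝ) : 0 < periodIntegral j ρ θ := by
  rw [periodIntegral, partialPrimitive_update]
  exact intervalIntegral.intervalIntegral_pos_of_pos
    ((continuous_comp_update hρ θ).intervalIntegrable _ _) (fun s => hpos _) Real.two_pi_pos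

theorem comp_update_add_latticeHom
    (hper : ∀ θ m, ρ (θ + latticeHom n m) = ρ θ) (θ : Fin n → ℝ) (m : Fin n → ℤ) (s : ℝ) :
    ρ (Function.update (θ + latticeHom n m) j s) = ρ (Function.update θ j s) := by
  rw [← hper (Function.update θ j s) (Function.update m j 0)]
  congr 1
  ext i
  rcases eq_or_ne i j with rfl | hi <;> simp [latticeHom_apply, *]

theorem periodIntegral_add_latticeHom
    (hper : ∀ θ m, ρ (θ + latticeHom n m) = ρ θ) (θ : Fin n → ℝ) (m : Fin n → ℤ) :
    periodIntegral j ρ (θ + latticeHom n m) = periodIntegral j ρ θ := by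
  simp only [periodIntegral, partialPrimitive_update, comp_update_add_latticeHom hper]

theorem partialPrimitive_add_latticeHom
    (hρ : AnalyticOnNhd ℝ ρ univ)
    (hper : ∀ θ m, ρ (θ + latticeHom n m) = ρ θ) (θ : Fin n → ℝ) (m : Fin n → ℤ) :
    partialPrimitive j ρ (θ + latticeHom n m) =
      partialPrimitive j ρ θ + m j * periodIntegral j ρ θ := by
  have hp : Function.Periodic (fun s => ρ (Function.update θ j s)) (2 * Real.pi) := by
    intro s
    have h := hper (Function.update θ j s) (Pi.single j 1)
    refine Eq.trans (congrArg ρ ?_) h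
    ext i
    rcases eq_or_ne i j with rfl | hi <;> simp [latticeHom_apply, *]
  have hint : ∀ a b, IntervalIntegrable (fun s => ρ (Function.update θ j s)) volume a b :=
    fun a b => (continuous_comp_update hρ θ).intervalIntegrable _ _
  have h := hp.intervalIntegral_add_zsmul_eq (m j) (θ j) hint
  rw [hp.intervalIntegral_add_eq (θ j) 0, zero_add, zsmul_eq_mul, zsmul_eq_mul] at h
  rw [periodIntegral, partialPrimitive_update, ← h]
  simp only [partialPrimitive, comp_update_add_latticeHom hper, Pi.add_apply, latticeHom_apply]
  exact (intervalIntegral.integral_add_adjacent_intervals (hint _ _) (hint _ _)).symm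

/-- The function `2π ∫_0^{θ_j} ρ / ∫_0^{2π} ρ`, with the integrals in the `j`-th variable: the
corresponding shear has Jacobian determinant `ρ` divided by its mean in the `j`-th variable. -/
noncomputable def meanPrimitive (j : Fin n) (ρ : (Fin n → ℝ) → ℝ) (θ : Fin n → ℝ) : ℝ :=
  2 * Real.pi * (partialPrimitive j ρ θ / periodIntegral j ρ θ)

theorem analyticOnNhd_meanPrimitive
    (hρ : AnalyticOnNhd ℝ ρ univ)
    (hpos : ∀ θ, 0 < ρ θ) : AnalyticOnNhd ℝ (meanPrimitive j ρ) univ := fun θ hθ =>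
  analyticAt_const.mul ((analyticOnNhd_partialPrimitive j hρ θ hθ).div
    (analyticOnNhd_periodIntegral hρ θ hθ) (periodIntegral_pos hρ hpos θ).ne')

theorem fderiv_meanPrimitive
    (hρ : AnalyticOnNhd ℝ ρ univ)
    (hpos : ∀ θ, 0 < ρ θ) (θ : Fin n → ℝ) :
    fderiv ℝ (meanPrimitive j ρ) θ (Pi.single j 1) =
      2 * Real.pi * (ρ θ / periodIntegral j ρ θ) := by
  have h1 := hasDerivAt_comp_update (f := meanPrimitive j ρ) (θ := θ) (j := j) (s := θ j)
    (by rw [Function.update_eq_self]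
        exact (analyticOnNhd_meanPrimitive hρ hpos θ (mem_univ _)).differentiableAt)
  rw [Function.update_eq_self] at h1
  refine h1.unique ?_
  simp only [meanPrimitive, partialPrimitive_update, periodIntegral_update]
  have h2 := ((continuous_comp_update (j := j) hρ θ).integral_hasStrictDerivAt 0 (θ j)).hasDerivAt
  rw [Function.update_eq_self] at h2
  exact (h2.div_const _).const_mul _

theorem isShearFunction_meanPrimitive
    (hρ : AnalyticOnNhd ℝ ρ univ)
    (hper : ∀ θ m, ρ (θ + latticeHom n m) = ρ θ)
    (hpos : ∀ θ, 0 < ρ θ) : IsShearFunction j (meanPrimitive j ρ) where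
  analytic := analyticOnNhd_meanPrimitive hρ hpos
  add_latticeHom θ m := by
    have := (periodIntegral_pos (j := j) hρ hpos θ).ne'
    rw [meanPrimitive, meanPrimitive, partialPrimitive_add_latticeHom hρ hper,
      periodIntegral_add_latticeHom hper]
    field_simp
  fderiv_pos θ := by
    rw [fderiv_meanPrimitive hρ hpos]
    have := periodIntegral_pos (j := j) hρ hpos θ
    have := hpos θ
    positivity

end Density

/-- A Knothe–Rosenblatt rearrangement: a positive periodic density `ρ` is, up to a constant, the
Jacobian determinant of a diffeomorphism whose first coordinate is a function of the first
coordinate only. The variables are treated one at a time, starting with the last one; each step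
replaces `ρ` by its mean in that variable. -/
theorem exists_isPeriodicDiffeo_det_eq [NeZero n] (k : ℕ) (hk : k ≤ n) {ρ : (Fin n → ℝ) → ℝ}
    (hρ : AnalyticOnNhd ℝ ρ univ) (hper : ∀ θ m, ρ (θ + latticeHom n m) = ρ θ)
    (hpos : ∀ θ, 0 < ρ θ) (hdep : ∀ θ θ', (∀ i : Fin n, i.val < k → θ i = θ' i) → ρ θ = ρ θ') :
    ∃ S : (Fin n → ℝ) ≃ (Fin n → ℝ), IsPeriodicDiffeo S ∧
      (∀ θ θ', S θ 0 = S θ' 0 ↔ θ 0 = θ' 0) ∧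
      ∃ c > 0, ∀ θ, (fderiv ℝ S θ).det = c * ρ θ := by
  induction k generalizing ρ with
  | zero =>
    have hconst : ∀ θ, ρ θ = ρ 0 := fun θ => hdep _ _ fun i hi => absurd hi (Nat.not_lt_zero _)
    refine ⟨Equiv.refl _, .refl, fun _ _ => Iff.rfl, (ρ 0)⁻¹, inv_pos.2 (hpos 0), fun θ => ?_⟩
    rw [hconst θ, inv_mul_cancel₀ (hpos 0).ne', Equiv.coe_refl, fderiv_id]
    exact LinearMap.det_id
  | succ k ih =>
    let j : Fin n := ⟨k, hk⟩
    have hpdep : ∀ θ θ', (∀ i : Fin n, i.val < k → θ i = θ' i) →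
        ∀ s, ρ (Function.update θ j s) = ρ (Function.update θ' j s) := by
      intro θ θ' h s
      refine hdep _ _ fun i hi => ?_
      rcases eq_or_ne i j with rfl | hij
      · simp
      · have : i.val ≠ k := fun h => hij (Fin.ext h)
        simp [hij, h i (by omega)]
    obtain ⟨S, hS, hS0, c, hc, hdet⟩ := ih (by omega) (ρ := periodIntegral j ρ)
      (analyticOnNhd_periodIntegral hρ) (periodIntegral_add_latticeHom hper)
      (periodIntegral_pos hρ hpos) fun θ θ' h => by
        simp only [periodIntegral, partialPrimitive_update, hpdep θ θ' h]
    have hE := isShearFunction_meanPrimitive (j := j) hρ hper hpos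
    refine ⟨hE.equiv.trans S, hE.isPeriodicDiffeo_equiv.trans hS, fun θ θ' => ?_,
      c * (2 * Real.pi), by positivity, fun θ => ?_⟩
    · rw [Equiv.trans_apply, Equiv.trans_apply, hS0, hE.equiv_apply, hE.equiv_apply]
      rcases eq_or_ne 0 j with h0 | h0
      · have hk0 : k = 0 := (congrArg Fin.val h0).symm
        have hdep0 : ∀ θ, meanPrimitive j ρ θ =
            meanPrimitive j ρ (Function.update 0 j (θ j)) := by
          intro θ
          have h1 := hpdep 0 θ fun i hi => by omega
          simp only [meanPrimitive, periodIntegral, partialPrimitive_update, Function.update_idem, h1]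
          rfl
        rw [h0, Function.update_self, Function.update_self, hdep0 θ, hdep0 θ']
        exact (hE.strictMono 0).injective.eq_iff
      · rw [Function.update_of_ne h0, Function.update_of_ne h0]
    · rw [hE.isPeriodicDiffeo_equiv.det_fderiv_trans hS, hdet, hE.det_fderiv_equiv,
        fderiv_meanPrimitive hρ hpos, hE.equiv_apply, periodIntegral_update]
      have := (periodIntegral_pos (j := j) hρ hpos θ).ne'
      field_simp

/-! ### Liftings and the volume of the torus -/

theorem cover_surjective : Function.Surjective (cover : (Fin n → ℝ) → Torus n) :=
  Function.Surjective.piMap fun _ => Circle.exp_surjective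

theorem cover_add_latticeHom (θ : Fin n → ℝ) (m : Fin n → ℤ) :
    cover (θ + latticeHom n m) = cover θ :=
  cover_eq_cover_iff.2 ⟨m, rfl⟩

theorem IsPeriodicDiffeo.cover_apply_surjInv {S : (Fin n → ℝ) ≃ (Fin n → ℝ)}
    (hS : IsPeriodicDiffeo S) (θ : Fin n → ℝ) :
    cover (S (Function.surjInv cover_surjective (cover θ))) = cover (S θ) := by
  obtain ⟨m, hm⟩ := cover_eq_cover_iff.1 (Function.surjInv_eq cover_surjective (cover θ))
  rw [hm, hS.add_latticeHom, cover_add_latticeHom]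

theorem IsPeriodicDiffeo.exists_isLift {S : (Fin n → ℝ) ≃ (Fin n → ℝ)} (hS : IsPeriodicDiffeo S) :
    ∃ Φ : Torus n ≃ Torus n, IsAnalyticDiffeo Φ ∧ IsLift Φ S := by
  let Φ : Torus n ≃ Torus n :=
    { toFun := fun z => cover (S (Function.surjInv cover_surjective z))
      invFun := fun z => cover (S.symm (Function.surjInv cover_surjective z))
      left_inv := fun z => by
        obtain ⟨θ, rfl⟩ := cover_surjective z
        simp [hS.cover_apply_surjInv, hS.symm.cover_apply_surjInv]
      right_inv := fun z => by
        obtain ⟨θ, rfl⟩ := cover_surjective z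
        simp [hS.cover_apply_surjInv, hS.symm.cover_apply_surjInv] }
  have han : ∀ {S' : (Fin n → ℝ) ≃ (Fin n → ℝ)} (hS' : IsPeriodicDiffeo S') (j : Fin n),
      AnalyticOnNhd ℝ (fun θ => (Circle.exp (S' θ j) : ℂ)) univ := by
    intro S' hS' j θ hθ
    simp only [Circle.coe_exp]
    have h1 : AnalyticAt ℝ (fun θ => ((S' θ j : ℝ) : ℂ)) θ :=
      (Complex.ofRealCLM.analyticAt _).comp (f := fun θ => S' θ j)
        (analyticAt_pi_iff.1 (hS'.analytic θ hθ) j)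
    exact (analyticAt_cexp.restrictScalars (𝕜 := ℝ)).comp (h1.mul analyticAt_const)
  refine ⟨Φ, ⟨fun j => ?_, fun j => ?_⟩, hS.continuous, fun θ => (hS.cover_apply_surjInv θ).symm⟩
  · convert! han hS j using 3 with θ
    exact congrArg Subtype.val (congrFun (hS.cover_apply_surjInv θ) j)
  · convert! han hS.symm j using 3 with θ
    exact congrArg Subtype.val (congrFun (hS.symm.cover_apply_surjInv θ) j)

theorem IsLift.exists_eq_add_const {Φ : Torus n → Torus n} {F F' : (Fin n → ℝ) → (Fin n → ℝ)}
    (hF : IsLift Φ F) (hF' : IsLift Φ F') : ∃ v, F = fun θ => F' θ + v := by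
  have h : ∀ θ, ∃ m : Fin n → ℤ, F θ = F' θ + latticeHom n m := fun θ =>
    cover_eq_cover_iff.1 ((hF.2 θ).trans (hF'.2 θ).symm)
  have hdisc : IsDiscrete (range fun k : ℤ => (k : ℝ)) :=
    Int.isClosedEmbedding_coe_real.isEmbedding.isDiscrete_range
  refine ⟨F 0 - F' 0, funext fun θ => funext fun j => ?_⟩
  have hc : ContinuousOn (fun θ => (F θ j - F' θ j) / (2 * Real.pi)) univ := by
    have h1 := (continuous_apply j).comp hF.1
    have h2 := (continuous_apply j).comp hF'.1
    exact ((h1.sub h2).div_const _).continuousOn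
  have hconst := isPreconnected_univ.constant_of_mapsTo hdisc hc
    (fun θ _ => by
      obtain ⟨m, hm⟩ := h θ
      refine ⟨m j, ?_⟩
      simp only [hm, Pi.add_apply, latticeHom_apply]
      field_simp
      ring) (mem_univ θ) (mem_univ 0)
  have hpi := Real.pi_ne_zero
  field_simp at hconst
  simp only [Pi.add_apply, Pi.sub_apply]
  linarith

/-- The fundamental box `(0, 2π]ⁿ`. -/
def box (n : ℕ) : Set (Fin n → ℝ) := univ.pi fun _ => Ioc 0 (2 * Real.pi)

theorem measurableSet_box : MeasurableSet (box n) :=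
  MeasurableSet.univ_pi fun _ => measurableSet_Ioc

theorem exists_add_latticeHom_mem_box (θ : Fin n → ℝ) :
    ∃ m : Fin n → ℤ, θ + latticeHom n m ∈ box n := by
  refine ⟨fun j => -toIocDiv Real.two_pi_pos 0 (θ j), fun j _ => ?_⟩
  have h := sub_toIocDiv_zsmul_mem_Ioc Real.two_pi_pos 0 (θ j)
  simpa [latticeHom_apply, sub_eq_add_neg] using h

theorem injOn_cover_box : InjOn cover (box n) := by
  intro a ha b hb hab
  obtain ⟨m, rfl⟩ := cover_eq_cover_iff.1 hab
  ext j
  have h1 := ha j (mem_univ j)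
  have h2 := hb j (mem_univ j)
  simp only [Pi.add_apply, latticeHom_apply, mem_Ioc] at h1 h2 ⊢
  have h3 : (m j : ℝ) < 1 := by nlinarith [Real.pi_pos]
  have h4 : (-1 : ℝ) < m j := by nlinarith [Real.pi_pos]
  have h5 : m j < 1 := by exact_mod_cast h3
  have h6 : -1 < m j := by exact_mod_cast h4
  simp [show m j = 0 by omega]

instance : Countable (latticeHom n).range := (countable_range (latticeHom n)).to_subtype

theorem IsLift.injOn_box {Φ : Torus n ≃ Torus n} {F : (Fin n → ℝ) → (Fin n → ℝ)}
    (hF : IsLift Φ F) : InjOn F (box n) := by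
  intro a ha b hb hab
  refine injOn_cover_box ha hb (Φ.injective ?_)
  rw [← hF.2, ← hF.2, hab]

/-- A lifting of a homeomorphism maps the fundamental box to another fundamental domain. -/
theorem IsLift.isAddFundamentalDomain_image_box {Φ : Torus n ≃ Torus n}
    {F : (Fin n → ℝ) → (Fin n → ℝ)} (hF : IsLift Φ F) :
    IsAddFundamentalDomain (latticeHom n).range (F '' box n) volume := by
  refine IsAddFundamentalDomain.mk' (measurableSet_box.image_of_continuousOn_injOn
    hF.1.continuousOn hF.injOn_box).nullMeasurableSet fun x => ?_
  obtain ⟨θ, hθ⟩ := cover_surjective (Φ.symm (cover x))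
  obtain ⟨m, hm⟩ := exists_add_latticeHom_mem_box θ
  have h1 : cover (F (θ + latticeHom n m)) = cover x := by
    rw [hF.2, cover_add_latticeHom, hθ, Equiv.apply_symm_apply]
  obtain ⟨m', hm'⟩ := cover_eq_cover_iff.1 h1
  refine ⟨⟨latticeHom n m', m', rfl⟩, ⟨_, hm, ?_⟩, ?_⟩
  · rw [hm', add_comm]
    rfl
  · rintro ⟨_, m'', rfl⟩ ⟨q, hq, hqx⟩
    have hqx' : F q = x + latticeHom n m'' := hqx.trans (add_comm _ _)
    have h2 : q = θ + latticeHom n m := by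
      refine injOn_cover_box hq hm (Φ.injective ?_)
      rw [← hF.2, ← hF.2, h1, hqx', cover_add_latticeHom]
    rw [← h2, hqx'] at hm'
    exact Subtype.ext (add_left_cancel hm')

theorem isAddFundamentalDomain_box :
    IsAddFundamentalDomain (latticeHom n).range (box n) volume := by
  have h : IsLift (Equiv.refl (Torus n)) (id : (Fin n → ℝ) → (Fin n → ℝ)) :=
    ⟨continuous_id, fun _ => rfl⟩
  simpa using h.isAddFundamentalDomain_image_box

/-- Change of variables for a lifting `F` with constant Jacobian determinant: the image of the box
under `F` may be replaced by the box itself, as the set `A` is periodic. -/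
theorem IsLift.volume_inter_box {Φ : Torus n ≃ Torus n} {F : (Fin n → ℝ) → (Fin n → ℝ)}
    (hF : IsLift Φ F) (hd : Differentiable ℝ F) {c : ℝ} (hdet : ∀ θ, (fderiv ℝ F θ).det = c)
    {A : Set (Fin n → ℝ)} (hA : MeasurableSet A)
    (hAm : ∀ θ m, θ + latticeHom n m ∈ A ↔ θ ∈ A) :
    volume (A ∩ box n) = ENNReal.ofReal |c| * volume (F ⁻¹' A ∩ box n) := by
  rw [isAddFundamentalDomain_box.measure_set_eq hF.isAddFundamentalDomain_image_box hA ?_,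
    ← image_preimage_inter, ← lintegral_abs_det_fderiv_eq_addHaar_image volume
      ((hF.1.measurable hA).inter measurableSet_box)
      (fun θ _ => (hd θ).hasFDerivAt.hasFDerivWithinAt) (hF.injOn_box.mono inter_subset_right)]
  · simp [hdet]
  · rintro ⟨_, m, rfl⟩
    ext θ
    rw [← hAm θ m, add_comm]
    rfl

theorem volume_box_ne_zero : volume (box n) ≠ 0 := by
  rw [box, volume_pi_pi]
  simp [Real.pi_pos]

theorem volume_box_ne_top : volume (box n) ≠ ∞ := by
  rw [box, volume_pi_pi]
  simp [ENNReal.mul_eq_top]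

/-- A lifting of a bijection of the torus with constant Jacobian determinant preserves volume. -/
theorem IsLift.abs_det_eq_one {Φ : Torus n ≃ Torus n} {F : (Fin n → ℝ) → (Fin n → ℝ)}
    (hF : IsLift Φ F) (hd : Differentiable ℝ F) {c : ℝ} (hdet : ∀ θ, (fderiv ℝ F θ).det = c) :
    |c| = 1 := by
  have h := hF.volume_inter_box hd hdet MeasurableSet.univ (by simp)
  rw [preimage_univ, univ_inter] at h
  have h1 : ENNReal.ofReal |c| = 1 := by
    rw [← ENNReal.mul_left_inj (volume_box_ne_zero (n := n)) volume_box_ne_top, one_mul, ← h]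
  simpa using h1

theorem volume_apply_zero_mem_inter_box [NeZero n] (T : Set ℝ) :
    volume ({θ : Fin n → ℝ | θ 0 ∈ T} ∩ box n) =
      volume (T ∩ Ioc 0 (2 * Real.pi)) * ENNReal.ofReal (2 * Real.pi) ^ (n - 1) := by
  have h : {θ : Fin n → ℝ | θ 0 ∈ T} ∩ box n = univ.pi
      (Function.update (fun _ => Ioc 0 (2 * Real.pi)) 0 (T ∩ Ioc 0 (2 * Real.pi))) := by
    ext θ
    simp only [box, mem_inter_iff, mem_ofPred_eq, mem_univ_pi]
    constructor
    · rintro ⟨h0, h⟩ i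
      rcases eq_or_ne i 0 with rfl | hi
      · simpa [h0] using h 0
      · simpa [hi] using h i
    · intro h
      have h0 := h 0
      rw [Function.update_self] at h0
      refine ⟨h0.1, fun i => ?_⟩
      rcases eq_or_ne i 0 with rfl | hi
      · exact h0.2
      · simpa [hi] using h i
  rw [h, volume_pi_pi]
  have h1 : ∀ i, volume (Function.update (fun _ => Ioc 0 (2 * Real.pi)) 0
      (T ∩ Ioc 0 (2 * Real.pi)) i) = Function.update (fun _ => volume (Ioc 0 (2 * Real.pi)))
        (0 : Fin n) (volume (T ∩ Ioc 0 (2 * Real.pi))) i := fun i =>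
    Function.apply_update (fun _ s => volume s) _ _ _ i
  rw [Finset.prod_congr rfl fun i _ => h1 i, Finset.prod_update_of_mem (Finset.mem_univ _)]
  simp [Finset.card_sdiff]

/-! ### Rigidity of monotone maps of the circle -/

/-- The `2π`-periodic set generated by `(a, b]`. -/
def periodicIoc (a b : ℝ) : Set ℝ := ⋃ k : ℤ, (fun t => t + k * (2 * Real.pi)) ⁻¹' Ioc a b

theorem measurableSet_periodicIoc (a b : ℝ) : MeasurableSet (periodicIoc a b) :=
  MeasurableSet.iUnion fun _ => (measurable_id.add_const _) measurableSet_Ioc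

theorem add_mem_periodicIoc {a b t : ℝ} (m : ℤ) :
    t + m * (2 * Real.pi) ∈ periodicIoc a b ↔ t ∈ periodicIoc a b := by
  simp only [periodicIoc, mem_iUnion, mem_preimage]
  constructor
  · rintro ⟨k, hk⟩
    refine ⟨m + k, ?_⟩
    push_cast
    rwa [add_mul, ← add_assoc]
  · rintro ⟨k, hk⟩
    refine ⟨k - m, ?_⟩
    push_cast
    convert! hk using 1
    ring

section Rigidity

variable {u v : ℝ ≃o ℝ}

theorem add_int_mul_of_add_two_pi {u : ℝ → ℝ} (hu : ∀ t, u (t + 2 * Real.pi) = u t + 2 * Real.pi)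
    (t : ℝ) (m : ℤ) : u (t + m * (2 * Real.pi)) = u t + m * (2 * Real.pi) := by
  have h : Function.Periodic (fun t => u t - t) (2 * Real.pi) := fun t => by
    simp only [hu]
    ring
  have h1 : u (t + m * (2 * Real.pi)) - (t + m * (2 * Real.pi)) = u t - t := h.int_mul m t
  linarith

theorem volume_preimage_periodicIoc (hu : ∀ t, u (t + 2 * Real.pi) = u t + 2 * Real.pi) {a b : ℝ}
    (hb : b ≤ a + 2 * Real.pi) :
    volume (u ⁻¹' periodicIoc a b ∩ Ioc 0 (2 * Real.pi)) =
      ENNReal.ofReal (u.symm b - u.symm a) := by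
  have h1 := (isAddFundamentalDomain_Ioc Real.two_pi_pos 0).measure_set_eq
    (isAddFundamentalDomain_Ioc Real.two_pi_pos (u.symm a))
    (A := u ⁻¹' periodicIoc a b)
    (u.monotone.measurable (measurableSet_periodicIoc a b)) ?_
  · rw [zero_add] at h1
    rw [h1, ← Real.volume_Ioc]
    congr 1
    ext t
    have h2 : t ≤ u.symm a + 2 * Real.pi ↔ u t ≤ a + 2 * Real.pi := by
      rw [← u.le_iff_le, hu, u.apply_symm_apply]
    simp only [mem_inter_iff, mem_preimage, mem_Ioc, h2, u.symm_apply_lt, u.le_symm_apply]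
    constructor
    · rintro ⟨hmem, hat, hta⟩
      obtain ⟨k, hk⟩ := mem_iUnion.1 hmem
      simp only [mem_preimage, mem_Ioc] at hk
      have h3 : (k : ℝ) < 1 := by nlinarith [Real.pi_pos]
      have h4 : (-1 : ℝ) < k := by nlinarith [Real.pi_pos]
      have h5 : k < 1 := by exact_mod_cast h3
      have h6 : -1 < k := by exact_mod_cast h4
      obtain rfl : k = 0 := by omega
      simpa using hk
    · rintro ⟨hat, htb⟩
      exact ⟨mem_iUnion.2 ⟨0, by simpa using ⟨hat, htb⟩⟩, hat, htb.trans hb⟩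
  · rintro ⟨_, m, rfl⟩
    ext t
    rw [mem_preimage, mem_preimage, mem_preimage, ← add_mem_periodicIoc m (t := u t),
      ← add_int_mul_of_add_two_pi hu, add_comm t]
    simp [AddSubgroup.vadd_def]

/-- Two increasing homeomorphisms of the circle with the same push-forward of Lebesgue measure
differ by a rotation of the source. -/
theorem exists_eq_comp_add (hu : ∀ t, u (t + 2 * Real.pi) = u t + 2 * Real.pi)
    (hv : ∀ t, v (t + 2 * Real.pi) = v t + 2 * Real.pi)
    (h : ∀ a b, volume (u ⁻¹' periodicIoc a b ∩ Ioc 0 (2 * Real.pi)) =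
      volume (v ⁻¹' periodicIoc a b ∩ Ioc 0 (2 * Real.pi))) :
    ∃ d, ∀ t, u t = v (t + d) := by
  have hsymm : ∀ {w : ℝ ≃o ℝ}, (∀ t, w (t + 2 * Real.pi) = w t + 2 * Real.pi) →
      ∀ t, w.symm (t + 2 * Real.pi) = w.symm t + 2 * Real.pi := by
    intro w hw t
    rw [OrderIso.symm_apply_eq, hw, w.apply_symm_apply]
  have hper : Function.Periodic (fun b => v.symm b - u.symm b) (2 * Real.pi) := fun b => by
    simp only [hsymm hu, hsymm hv]
    ring
  have hIoc : ∀ b ∈ Ioc 0 (2 * Real.pi),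
      v.symm b - u.symm b = v.symm 0 - u.symm 0 := by
    intro b hb
    have h1 := h 0 b
    have hb2 : b ≤ 0 + 2 * Real.pi := by simpa using hb.2
    rw [volume_preimage_periodicIoc hu hb2, volume_preimage_periodicIoc hv hb2,
      ENNReal.ofReal_eq_ofReal_iff (sub_nonneg.2 (u.symm.monotone hb.1.le))
        (sub_nonneg.2 (v.symm.monotone hb.1.le))] at h1
    linarith
  refine ⟨v.symm 0 - u.symm 0, fun t => ?_⟩
  have h1 : v.symm (u t) - u.symm (u t) = v.symm 0 - u.symm 0 := by
    rw [← hIoc (toIocMod Real.two_pi_pos 0 (u t)) (by simpa using toIocMod_mem_Ioc _ 0 (u t)),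
      ← self_sub_toIocDiv_zsmul]
    exact (hper.sub_zsmul_eq _).symm
  rw [← h1, u.symm_apply_apply, add_sub_cancel, v.apply_symm_apply]

end Rigidity

variable [NeZero n]

/-! ### The normal form of a function without critical points -/

/-- `k` is periodic with mean zero, and `θ ↦ θ_1 + k θ_1` is obtained from `M` by composition with
a lifting of a volume-preserving analytic diffeomorphism of the torus. -/
def IsNormalForm (M : (Fin n → ℝ) → ℝ) (k : ℝ → ℝ) : Prop :=
  Function.Periodic k (2 * Real.pi) ∧ (∫ t in (0 : ℝ)..(2 * Real.pi), k t) = 0 ∧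
    ∃ Φ : Torus n ≃ Torus n, IsAnalyticDiffeo Φ ∧ IsVolumePreserving Φ ∧
      ∃ F : (Fin n → ℝ) → (Fin n → ℝ), IsLift Φ F ∧ ∀ θ, M (F θ) = θ 0 + k (θ 0)

section

variable {M : (Fin n → ℝ) → ℝ}

/-- After composition with a suitable diffeomorphism of Jacobian determinant one, `M` depends on
the first coordinate only. -/
theorem IsShearFunction.exists_isPeriodicDiffeo (hM : IsShearFunction 0 M) :
    ∃ G : (Fin n → ℝ) ≃ (Fin n → ℝ), IsPeriodicDiffeo G ∧ (∀ θ, (fderiv ℝ G θ).det = 1) ∧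
      ∀ θ θ', θ 0 = θ' 0 → M (G θ) = M (G θ') := by
  have hE := hM.isPeriodicDiffeo_equiv
  obtain ⟨S, hS, hS0, c, hc, hdet⟩ := exists_isPeriodicDiffeo_det_eq n le_rfl
    (ρ := fun θ => (fderiv ℝ M (hM.equiv.symm θ) (Pi.single 0 1))⁻¹)
    (fun θ hθ => AnalyticAt.inv
      ((((ContinuousLinearMap.apply ℝ ℝ (Pi.single 0 1 : Fin n → ℝ)).analyticAt _).comp
        (hM.analytic.fderiv _ (mem_univ _))).comp (hE.analytic_symm θ hθ))
      (hM.fderiv_pos _).ne')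
    (fun θ m => by rw [hE.symm.add_latticeHom, hM.fderiv_add_latticeHom])
    (fun θ => inv_pos.2 (hM.fderiv_pos _))
    (fun θ θ' h => by rw [show θ = θ' from funext fun i => h i i.2])
  have hH := hE.trans hS
  have hHdet : ∀ θ, (fderiv ℝ (hM.equiv.trans S) θ).det = c := fun θ => by
    have := (hM.fderiv_pos θ).ne'
    rw [hE.det_fderiv_trans hS, hdet, hM.det_fderiv_equiv, Equiv.symm_apply_apply]
    field_simp
  obtain ⟨Φ, -, hΦ⟩ := hH.exists_isLift
  have hc1 : c = 1 := by
    have := hΦ.abs_det_eq_one hH.differentiable hHdet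
    rwa [abs_of_pos hc] at this
  refine ⟨_, hH.symm, fun θ => ?_, fun θ θ' h => ?_⟩
  · have := hH.det_fderiv_symm θ
    rwa [hHdet, hc1, mul_one] at this
  · have h1 : ∀ θ, M ((hM.equiv.trans S).symm θ) = S.symm θ 0 := fun θ => by
      have h2 := hM.equiv_apply ((hM.equiv.trans S).symm θ)
      rw [Equiv.symm_trans_apply, Equiv.apply_symm_apply] at h2
      rw [h2, Function.update_self]
      rfl
    rw [h1, h1, ← hS0, Equiv.apply_symm_apply, Equiv.apply_symm_apply, h]

/-- The mean of `k` is made zero by a translation of the first angle. -/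
theorem IsShearFunction.exists_isNormalForm (hM : IsShearFunction 0 M) :
    ∃ k, IsNormalForm M k := by
  obtain ⟨G, hG, hdet, hdep⟩ := hM.exists_isPeriodicDiffeo
  let p : ℝ → ℝ := fun t => M (G (Pi.single 0 t)) - t
  have hp : Function.Periodic p (2 * Real.pi) := by
    intro t
    have h : (Pi.single 0 (t + 2 * Real.pi) : Fin n → ℝ) =
        Pi.single 0 t + latticeHom n (Pi.single 0 1) := by
      rw [latticeHom_single, ← Pi.single_add]
      simp
    simp only [p]
    rw [h, hG.add_latticeHom, hM.add_latticeHom]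
    simp
  have hpc : Continuous p := by
    have h1 : Continuous fun t : ℝ => (Pi.single 0 t : Fin n → ℝ) :=
      continuous_const.update 0 continuous_id
    exact (hM.differentiable.continuous.comp (hG.continuous.comp h1)).sub continuous_id
  -- translating the first angle by `d` changes the mean by `d`
  let d : ℝ := -(∫ t in (0 : ℝ)..(2 * Real.pi), p t) / (2 * Real.pi)
  let T : (Fin n → ℝ) ≃ (Fin n → ℝ) := Equiv.addRight (Pi.single 0 d)
  have hT : IsPeriodicDiffeo T := .addRight _
  have hTG := hT.trans hG
  obtain ⟨Φ, hΦ, hlift⟩ := hTG.exists_isLift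
  refine ⟨fun t => p (t + d) + d, fun t => ?_, ?_, Φ, hΦ,
    ⟨_, hlift, hTG.differentiable, fun θ => ?_⟩, _, hlift, fun θ => ?_⟩
  · have := hp (t + d)
    rw [add_right_comm] at this
    simp only [this]
  · have hpd : Continuous fun t => p (t + d) := hpc.comp (continuous_add_const d)
    beta_reduce
    rw [intervalIntegral.integral_add
      (hpd.intervalIntegrable _ _) (by simp),
      intervalIntegral.integral_comp_add_right, zero_add, add_comm _ d,
      hp.intervalIntegral_add_eq d 0, zero_add, intervalIntegral.integral_const]
    simp only [d, smul_eq_mul, sub_zero]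
    have := Real.pi_ne_zero
    field_simp
    ring
  · rw [hT.det_fderiv_trans hG, hdet, one_mul]
    have : fderiv ℝ T θ = ContinuousLinearMap.id ℝ _ := by
      simp only [T, Equiv.coe_addRight]
      rw [fderiv_add_const, fderiv_fun_id]
    rw [this]
    exact LinearMap.det_id
  · rw [Equiv.trans_apply, hdep (T θ) (Pi.single 0 (θ 0 + d)) (by simp [T])]
    simp only [p]
    ring

/-- The function `t ↦ t + k t` is a homeomorphism, and its push-forward of Lebesgue measure is
determined by `M`. -/
theorem IsNormalForm.exists_orderIso (hM : IsShearFunction 0 M) {k : ℝ → ℝ}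
    (hk : IsNormalForm M k) :
    ∃ u : ℝ ≃o ℝ, (∀ t, u t = t + k t) ∧ ∀ a b,
      volume (M ⁻¹' periodicIoc a b ∩ box n) =
        volume (u ⁻¹' periodicIoc a b ∩ Ioc 0 (2 * Real.pi)) *
          ENNReal.ofReal (2 * Real.pi) ^ (n - 1) := by
  obtain ⟨hper, -, Φ, -, ⟨F', hF', hd', hdet'⟩, F, hF, hMF⟩ := hk
  obtain ⟨v, rfl⟩ := hF.exists_eq_add_const hF'
  have hd : Differentiable ℝ fun θ => F' θ + v := hd'.add_const v
  have hdet : ∀ θ, (fderiv ℝ (fun θ => F' θ + v) θ).det = 1 := fun θ => by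
    rw [fderiv_add_const, hdet']
  let u : ℝ → ℝ := fun t => t + k t
  have hu2 : ∀ t, u (t + 2 * Real.pi) = u t + 2 * Real.pi := fun t => by
    simp only [u, hper t]
    ring
  have hu : ∀ θ : Fin n → ℝ, M (F' θ + v) = u (θ 0) := hMF
  have hMd : ∀ θ, HasFDerivAt (fun θ => M (F' θ + v))
      ((fderiv ℝ M (F' θ + v)).comp (fderiv ℝ (fun θ => F' θ + v) θ)) θ := fun θ =>
    (hM.differentiable _).hasFDerivAt.comp θ (f := fun θ => F' θ + v) (hd θ).hasFDerivAt
  have hud : ∀ t, HasDerivAt u ((fderiv ℝ M (F' (Pi.single 0 t) + v)).comp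
      (fderiv ℝ (fun θ => F' θ + v) (Pi.single 0 t)) (Pi.single 0 1)) t := by
    intro t
    have h1 : HasDerivAt (fun t : ℝ => (Pi.single 0 t : Fin n → ℝ)) (Pi.single 0 1) t :=
      hasDerivAt_update 0 0 t
    have h2 := (hMd (Pi.single 0 t)).comp_hasDerivAt t h1
    refine h2.congr_of_eventuallyEq (Eventually.of_forall fun s => ?_)
    simp [hu]
  have hne : ∀ t, deriv u t ≠ 0 := by
    intro t ht
    set θ : Fin n → ℝ := Pi.single 0 t
    -- otherwise `M` would have a critical point, since `F'` is a local diffeomorphism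
    have h1 : HasFDerivAt (fun θ : Fin n → ℝ => u (θ 0))
        (deriv u t • ContinuousLinearMap.proj (R := ℝ) (φ := fun _ : Fin n => ℝ) 0) θ := by
      have h2 : HasDerivAt u (deriv u t) (θ 0) := by
        simpa [θ] using (hud t).differentiableAt.hasDerivAt
      exact h2.comp_hasFDerivAt (f := fun θ : Fin n → ℝ => θ 0) θ (hasFDerivAt_apply 0 θ)
    simp only [← hu] at h1
    have h3 := (hMd θ).unique h1
    let i := (fderiv ℝ (fun θ => F' θ + v) θ).toContinuousLinearEquivOfDetNeZero
      (by rw [hdet]; exact one_ne_zero)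
    have h4 := congrArg (fun L => L (i.symm (Pi.single 0 1))) h3
    have h5 : fderiv ℝ (fun θ => F' θ + v) θ (i.symm (Pi.single 0 1)) = Pi.single 0 1 :=
      i.apply_symm_apply _
    rw [ht] at h4
    simp only [ContinuousLinearMap.comp_apply, h5, zero_smul] at h4
    exact (hM.fderiv_pos _).ne' h4
  have hpos : ∀ t, 0 < deriv u t := by
    rcases hasDerivWithinAt_forall_lt_or_forall_gt_of_forall_ne convex_univ
      (fun t _ => (hud t).differentiableAt.hasDerivAt.hasDerivWithinAt) (m := 0)
      (fun t _ => hne t) with h | h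
    · have h1 := strictAnti_of_deriv_neg fun t => h t (mem_univ t)
      have h2 := h1 Real.two_pi_pos
      have h3 := hu2 0
      rw [zero_add] at h3
      linarith [Real.pi_pos]
    · exact fun t => h t (mem_univ t)
  have hmono : StrictMono u := strictMono_of_deriv_pos hpos
  have hcont : Continuous u := continuous_iff_continuousAt.2 fun t => (hud t).continuousAt
  have hsurj : Function.Surjective u := by
    intro y
    have hz : ∀ m : ℤ, u (m * (2 * Real.pi)) = u 0 + m * (2 * Real.pi) := fun m => by
      simpa using add_int_mul_of_add_two_pi hu2 0 m
    obtain ⟨m, hm⟩ := exists_add_latticeHom_mem_box (fun _ : Fin n => y - u 0)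
    have h0 := hm 0 (mem_univ _)
    simp only [Pi.add_apply, latticeHom_apply, mem_Ioc] at h0
    refine mem_range_of_exists_le_of_exists_ge hcont
      ⟨((-m 0 : ℤ) : ℝ) * (2 * Real.pi), ?_⟩ ⟨((-m 0 + 1 : ℤ) : ℝ) * (2 * Real.pi), ?_⟩
    · rw [hz]
      push_cast
      linarith
    · rw [hz]
      push_cast
      linarith
  refine ⟨hmono.orderIsoOfSurjective u hsurj, fun t => rfl, fun a b => ?_⟩
  rw [hF.volume_inter_box hd hdet
    (hM.differentiable.continuous.measurable (measurableSet_periodicIoc a b)) fun θ m => by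
      rw [mem_preimage, mem_preimage, hM.add_latticeHom, add_mem_periodicIoc], abs_one,
    ENNReal.ofReal_one, one_mul, ← volume_apply_zero_mem_inter_box]
  congr 2
  ext θ
  simp only [mem_preimage, hu]
  rfl

theorem IsNormalForm.unique (hM : IsShearFunction 0 M) {k₁ k₂ : ℝ → ℝ}
    (h₁ : IsNormalForm M k₁) (h₂ : IsNormalForm M k₂) : k₁ = k₂ := by
  obtain ⟨u₁, hu₁, hv₁⟩ := h₁.exists_orderIso hM
  obtain ⟨u₂, hu₂, hv₂⟩ := h₂.exists_orderIso hM
  obtain ⟨hp₁, hi₁, -⟩ := h₁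
  obtain ⟨hp₂, hi₂, -⟩ := h₂
  obtain ⟨d, hd⟩ := exists_eq_comp_add (u := u₁) (v := u₂)
    (fun t => by rw [hu₁, hu₁, hp₁]; ring) (fun t => by rw [hu₂, hu₂, hp₂]; ring) fun a b => by
      have h := (hv₁ a b).symm.trans (hv₂ a b)
      rwa [ENNReal.mul_left_inj (pow_ne_zero _ (by simp [Real.pi_pos]))
        (ENNReal.pow_ne_top ENNReal.ofReal_ne_top)] at h
  have hk : ∀ t, k₁ t = k₂ (t + d) + d := fun t => by
    have := hd t
    rw [hu₁, hu₂] at this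
    linarith
  have hint : IntervalIntegrable k₂ volume (0 + d) (2 * Real.pi + d) := by
    have : k₂ = fun t => u₂ t - t := funext fun t => by rw [hu₂, add_sub_cancel_left]
    rw [this]
    exact (u₂.continuous.sub continuous_id).intervalIntegrable _ _
  have h0 : d = 0 := by
    simp only [hk] at hi₁
    rw [intervalIntegral.integral_add (by simpa using hint.comp_add_right d) (by simp),
      intervalIntegral.integral_comp_add_right, zero_add, add_comm _ d,
      hp₂.intervalIntegral_add_eq d 0, zero_add, hi₂, intervalIntegral.integral_const] at hi₁
    simpa [Real.pi_ne_zero] using hi₁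
  ext t
  rw [hk, h0, add_zero, add_zero]

theorem IsShearFunction.existsUnique_isNormalForm (hM : IsShearFunction 0 M) :
    ∃! k, IsNormalForm M k := by
  obtain ⟨k, hk⟩ := hM.exists_isNormalForm
  exact ⟨k, hk, fun k' hk' => hk'.unique hM hk⟩

end

/-! ### Small perturbations of the first angle -/

theorem isOpen_strip {n : ℕ} {r : ℝ} : IsOpen (strip n r) := by
  have : strip n r = ⋂ j, {θ | |(θ j).im| < r} := by
    ext
    simp [strip]
  rw [this]
  exact isOpen_iInter_of_finite fun j => isOpen_lt (by fun_prop) continuous_const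

theorem toComplex_mem_strip {n : ℕ} {r : ℝ} (hr : 0 < r) (θ : Fin n → ℝ) :
    toComplex θ ∈ strip n r := fun j => by simpa [toComplex] using hr

theorem norm_le_of_stripNorm_le {n : ℕ} {r C : ℝ} (hC : 0 ≤ C) {h : (Fin n → ℂ) → ℂ}
    (hh : stripNorm n r h ≤ ENNReal.ofReal C) {θ : Fin n → ℂ} (hθ : θ ∈ strip n r) :
    ‖h θ‖ ≤ C := by
  have h1 : ‖h θ‖ₑ ≤ ENNReal.ofReal C := (le_iSup₂ (f := fun θ _ => ‖h θ‖ₑ) θ hθ).trans hh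
  rwa [← ofReal_norm, ENNReal.ofReal_le_ofReal_iff hC] at h1

/-- Cauchy's estimate for the derivative in one variable. -/
theorem abs_fderiv_re_le {n : ℕ} {r C : ℝ} (hr : 0 < r) {h : (Fin n → ℂ) → ℂ}
    (hd : DifferentiableOn ℂ h (strip n r)) (hC : ∀ θ ∈ strip n r, ‖h θ‖ ≤ C) (θ : Fin n → ℝ)
    (j : Fin n) :
    |fderiv ℝ (fun θ : Fin n → ℝ => (h (toComplex θ)).re) θ (Pi.single j 1)| ≤ C / (r / 2) := by
  have hmem : ∀ z ∈ Metric.closedBall (θ j : ℂ) (r / 2),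
      Function.update (toComplex θ) j z ∈ strip n r := by
    intro z hz i
    rcases eq_or_ne i j with rfl | hi
    · rw [mem_closedBall_iff_norm] at hz
      have := (Complex.abs_im_le_norm (z - θ i)).trans hz
      simp only [Complex.sub_im, Complex.ofReal_im, sub_zero] at this
      simp only [Function.update_self]
      linarith
    · simpa [hi, toComplex] using hr
  have hdiff : ∀ z ∈ Metric.closedBall (θ j : ℂ) (r / 2),
      DifferentiableAt ℂ (fun z => h (Function.update (toComplex θ) j z)) z := fun z hz =>
    (hd.differentiableAt (isOpen_strip.mem_nhds (hmem z hz))).comp z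
      (f := fun z => Function.update (toComplex θ) j z)
      (hasDerivAt_update (toComplex θ) j z).differentiableAt
  have h1 := Complex.norm_deriv_le_of_forall_mem_sphere_norm_le (half_pos hr)
    (f := fun z => h (Function.update (toComplex θ) j z)) (c := θ j) (C := C)
    (DifferentiableOn.diffContOnCl fun z hz => (hdiff z
      (Metric.closure_ball_subset_closedBall hz)).differentiableWithinAt)
    fun z hz => hC _ (hmem z (Metric.sphere_subset_closedBall hz))
  have h2 := (hdiff _ (Metric.mem_closedBall_self (half_pos hr).le)).hasDerivAt.real_of_complex
  have h3 : DifferentiableAt ℝ (fun θ : Fin n → ℝ => (h (toComplex θ)).re)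
      (Function.update θ j (θ j)) := by
    have h4 := analyticAt_comp_toComplex isOpen_strip hd
      (toComplex_mem_strip hr (Function.update θ j (θ j)))
    exact ((Complex.reCLM.analyticAt _).comp h4).differentiableAt
  have h5 := hasDerivAt_comp_update h3
  rw [Function.update_eq_self] at h5
  have h6 : ∀ s : ℝ, toComplex (Function.update θ j s) = Function.update (toComplex θ) j (s : ℂ) := by
    intro s
    ext i
    rcases eq_or_ne i j with rfl | hi <;> simp [toComplex, *]
  simp only [h6] at h5
  rw [h5.unique h2]
  exact (Complex.abs_re_le_norm _).trans h1

theorem isShearFunction_add_re {r C : ℝ} (hr : 0 < r) {h : (Fin n → ℂ) → ℂ}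
    (hd : DifferentiableOn ℂ h (strip n r)) (hper : IsPeriodicOnStrip n r h)
    (hC : ∀ θ ∈ strip n r, ‖h θ‖ ≤ C) (hCr : C / (r / 2) < 1) :
    IsShearFunction 0 fun θ : Fin n → ℝ => θ 0 + (h (toComplex θ)).re := by
  have han : AnalyticOnNhd ℝ (fun θ : Fin n → ℝ => (h (toComplex θ)).re) univ := fun θ _ =>
    (Complex.reCLM.analyticAt _).comp
      (analyticAt_comp_toComplex isOpen_strip hd (toComplex_mem_strip hr θ))
  have han0 : AnalyticOnNhd ℝ (fun θ : Fin n → ℝ => θ 0) univ := fun θ _ =>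
    (ContinuousLinearMap.proj (R := ℝ) (φ := fun _ : Fin n => ℝ) 0).analyticAt θ
  refine ⟨han0.add han, fun θ m => ?_, fun θ => ?_⟩
  · have h1 := apply_add_latticeHom_of_forall_single (g := fun θ => h (toComplex θ))
      (fun θ j => by
        rw [← hper _ (toComplex_mem_strip hr θ) j]
        congr 1
        ext i
        rcases eq_or_ne i j with rfl | hi <;> simp [toComplex, *]) θ m
    beta_reduce at h1
    rw [h1, Pi.add_apply, latticeHom_apply]
    ring
  · have h1 : HasFDerivAt (fun θ : Fin n → ℝ => θ 0 + (h (toComplex θ)).re)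
        (ContinuousLinearMap.proj 0 + fderiv ℝ (fun θ : Fin n → ℝ => (h (toComplex θ)).re) θ) θ :=
      (hasFDerivAt_apply 0 θ).add (han θ (mem_univ _)).differentiableAt.hasFDerivAt
    have h2 := abs_le.1 (abs_fderiv_re_le hr hd hC θ 0)
    rw [h1.fderiv]
    simp only [add_apply, ContinuousLinearMap.proj_apply, Pi.single_eq_same]
    linarith

end TorusNormalForm

theorem theorem2p2 (n : ℕ) [NeZero n] :
    ∃ ε : ℝ, 0 < ε ∧
      ∀ r : ℝ, 0 < r → r < 1 →
      ∀ h : (Fin n → ℂ) → ℂ,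
        DifferentiableOn ℂ h (TorusNormalForm.strip n r) →
        TorusNormalForm.IsPeriodicOnStrip n r h →
        (∀ θ : Fin n → ℝ, (h (TorusNormalForm.toComplex θ)).im = 0) →
        TorusNormalForm.stripNorm n r h ≤ ENNReal.ofReal (ε * r ^ 3) →
        ∃! k : ℝ → ℝ,
          Function.Periodic k (2 * Real.pi) ∧
          (∫ t in (0 : ℝ)..(2 * Real.pi), k t) = 0 ∧
          ∃ Φ : TorusNormalForm.Torus n ≃ TorusNormalForm.Torus n,
            TorusNormalForm.IsAnalyticDiffeo Φ ∧
            TorusNormalForm.IsVolumePreserving Φ ∧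
            ∃ F : (Fin n → ℝ) → (Fin n → ℝ),
              TorusNormalForm.IsLift Φ F ∧
              ∀ θ : Fin n → ℝ,
                TorusNormalForm.mu h (TorusNormalForm.toComplex (F θ)) =
                  ((θ 0 + k (θ 0) : ℝ) : ℂ) := by
  -- with this `ε`, Cauchy's estimate on discs of radius `r / 2` bounds `|∂₁ h|` by `r² / 2`
  refine ⟨1 / 4, by norm_num, fun r hr hr1 h hd hper him hnorm => ?_⟩
  have hCr : 1 / 4 * r ^ 3 / (r / 2) < 1 := by
    rw [div_lt_one (by positivity)]
    nlinarith [mul_pos hr hr]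
  have hM := TorusNormalForm.isShearFunction_add_re hr hd hper
    (fun θ hθ => TorusNormalForm.norm_le_of_stripNorm_le (by positivity) hnorm hθ) hCr
  have hmu : ∀ θ : Fin n → ℝ, TorusNormalForm.mu h (TorusNormalForm.toComplex θ) =
      ((θ 0 + (h (TorusNormalForm.toComplex θ)).re : ℝ) : ℂ) := fun θ =>
    Complex.ext (by simp [TorusNormalForm.mu, TorusNormalForm.toComplex])
      (by simp [TorusNormalForm.mu, TorusNormalForm.toComplex, him θ])
  simp only [hmu, Complex.ofReal_inj]
  exact hM.existsUnique_isNormalForm
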